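/- Throughout, a convex polytope in $\mathbb{R}^n$ is the convex hull of a nonempty finite set of points (of any dimension $m\le n$). A zonotope is a set of the form $c+\{\sum_{i=1}^k t_i a_i : 0\le t_i\le 1\}$ with $k\ge 0$ and $c,a_1,\dots,a_k\in\mathbb{R}^n$; it is a parallelotope if $a_1,\dots,a_k$ can be chosen linearly independent. A tiling (decomposition) of a convex polytope $P$ is a finite set of convex polytopes, called tiles, whose union is $P$, each with the same affine span as $P$, and such that distinct tiles have disjoint relative interiors. A tiling is face-to-face if any two of its tiles meet in a (possibly empty) common face. Let $P\subset\mathbb{R}^n$ be a convex polytope. Then $P$ is a zonotope if and only if it has a face-to-face tiling by zonotopes. Equivalently, $P$ is a zonotope if and only if it has a face-to-face tiling by parallelotopes. Both equivalences also hold for tilings that are not required to be face-to-face. -/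

import Mathlib

open scoped Pointwise

/-- A convex polytope in `ℝⁿ`: the convex hull of a nonempty finite set of points
(of any dimension `≤ n`). -/
def IsConvexPolytope {n : ℕ} (P : Set (EuclideanSpace ℝ (Fin n))) : Prop :=
  ∃ s : Set (EuclideanSpace ℝ (Fin n)), s.Finite ∧ s.Nonempty ∧ P = convexHull ℝ s

/-- A zonotope: a translate `c + {∑ tᵢ aᵢ | 0 ≤ tᵢ ≤ 1}` of the linear image of a unit cube.
Mathlib's `parallelepiped a` is this image for an arbitrary, not necessarily linearly independent,
finite family `a`. -/
def IsZonotope {n : ℕ} (P : Set (EuclideanSpace ℝ (Fin n))) : Prop :=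
  ∃ (c : EuclideanSpace ℝ (Fin n)) (k : ℕ) (a : Fin k → EuclideanSpace ℝ (Fin n)),
    P = c +ᵥ parallelepiped a

/-- A parallelotope: a zonotope with linearly independent generators. It may have any
dimension `0 ≤ k ≤ n`. -/
def IsParallelotope {n : ℕ} (P : Set (EuclideanSpace ℝ (Fin n))) : Prop :=
  ∃ (c : EuclideanSpace ℝ (Fin n)) (k : ℕ) (a : Fin k → EuclideanSpace ℝ (Fin n)),
    LinearIndependent ℝ a ∧ P = c +ᵥ parallelepiped a

/-- The family `𝒯` of subsets of `ℝⁿ` is a tiling (decomposition) of `P`: it is finite, its union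
is `P`, its members have the same dimension as `P`, and distinct members have no common relative
interior point (for convex tiles: they meet in a set of lower dimension). -/
structure IsTiling {n : ℕ} (P : Set (EuclideanSpace ℝ (Fin n)))
    (𝒯 : Set (Set (EuclideanSpace ℝ (Fin n)))) : Prop where
  finite : 𝒯.Finite
  sUnion_eq : ⋃₀ 𝒯 = P
  affineSpan_eq : ∀ T ∈ 𝒯, affineSpan ℝ T = affineSpan ℝ P
  disjoint_interiors : ∀ S ∈ 𝒯, ∀ T ∈ 𝒯, S ≠ T →
    Disjoint (intrinsicInterior ℝ S) (intrinsicInterior ℝ T)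

/-- Any two members of the family meet in a (possibly empty) common face. The faces of a convex
polytope are its exposed subsets; `IsExposed` counts the empty set as one. -/
def IsFaceToFace {n : ℕ} (𝒯 : Set (Set (EuclideanSpace ℝ (Fin n)))) : Prop :=
  ∀ S ∈ 𝒯, ∀ T ∈ 𝒯, IsExposed ℝ S (S ∩ T) ∧ IsExposed ℝ T (S ∩ T)

/-- `P` has a tiling, not necessarily face-to-face, all of whose tiles have the property `p`. -/
def Decomposes {n : ℕ} (P : Set (EuclideanSpace ℝ (Fin n)))
    (p : Set (EuclideanSpace ℝ (Fin n)) → Prop) : Prop :=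
  ∃ 𝒯 : Set (Set (EuclideanSpace ℝ (Fin n))), IsTiling P 𝒯 ∧ ∀ T ∈ 𝒯, p T

/-- `P` has a face-to-face tiling all of whose tiles have the property `p`. -/
def DecomposesFaceToFace {n : ℕ} (P : Set (EuclideanSpace ℝ (Fin n)))
    (p : Set (EuclideanSpace ℝ (Fin n)) → Prop) : Prop :=
  ∃ 𝒯 : Set (Set (EuclideanSpace ℝ (Fin n))),
    IsTiling P 𝒯 ∧ IsFaceToFace 𝒯 ∧ ∀ T ∈ 𝒯, p T

/-! From a zonotope to a tiling: lift each generator `a i` to height `h i` and project the lower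
faces of the lifted zonotope. A functional `w` selects the tile `liftTile a h w`, where `∑ tᵢ (hᵢ -
w aᵢ)` is minimal over the cube; up to translation this is the parallelepiped of the active
generators, those with `w aᵢ = hᵢ`. Two tiles that meet do so in the face exposed by the difference
of their functionals (`liftTile_inter_eq`). For generic heights the active generators are
independent (`exists_generic_heights`). Tiles whose active generators span everything cover the
zonotope by linear programming duality: the dual function `dualGap` of a point attains its minimum
at a functional of this kind, and there the point lies in the tile (`exists_mem_liftTile`).

From a tiling to a zonotope: faces of zonotopes are centrally symmetric, and distinct tiles are
separated by hyperplanes not containing `P`. Slice a polygonal face of `P` parallel to one of its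
edges. The slice length of the face is, off finitely many positions, the sum of the slice lengths of
the tiles' faces. The slice length of a convex body jumps only at the two ends of its projection,
and for a symmetric body these jumps cancel; hence they cancel for the polygon too, and opposite
parallel edges have equal length (`fiberLength_eq_of_tiling`, `IsSeparatedTiling.volume_edge_eq`).

Edges of direction `l` correspond to chambers in the annihilator of `l`, and edges of adjacent
chambers lie on a common polygon. Chambers are connected through walls (`eq_of_forall_adjacent_eq`),
so all edges of direction `l` share one length `L l`. In the full dual space, crossing the wall of
`l` moves the maximizing vertex by `L l • l`. Therefore the vertex for a generic `w` is a constant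
plus the sum of `L l • l` over `w l > 0`, which is also the vertex of the zonotope with generators
`L l • l`. Agreement on generic functionals identifies the two bodies. -/

/-! ### Separation of convex sets inside their affine span -/

section General

variable {E : Type*} [NormedAddCommGroup E] [NormedSpace ℝ E]

/-- In finite dimension, a vector outside a subspace is detected by a continuous functional
vanishing on that subspace. -/
theorem exists_strongDual_ne_zero_of_notMem [FiniteDimensional ℝ E]
    {p : Submodule ℝ E} {v : E} (hv : v ∉ p) :
    ∃ d : StrongDual ℝ E, (∀ x ∈ p, d x = 0) ∧ d v ≠ 0 := by
  obtain ⟨f, hf, hp⟩ := Submodule.exists_le_ker_of_notMem hv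
  exact ⟨LinearMap.toContinuousLinearMap f, fun x hx => hp hx, hf⟩

/-- A functional that attains its maximum over a set at a point of the intrinsic interior is
constant on the set. -/
theorem eq_of_mem_intrinsicInterior_of_forall_le {A : Set E} {x : E}
    (hx : x ∈ intrinsicInterior ℝ A) (f : StrongDual ℝ E) (hf : ∀ y ∈ A, f y ≤ f x) :
    ∀ y ∈ A, f y = f x := by
  intro y hy
  refine le_antisymm (hf y hy) ?_
  obtain ⟨z, hz, rfl⟩ := mem_intrinsicInterior.1 hx
  have hmem : ∀ t : ℝ, AffineMap.lineMap (z : E) y t ∈ affineSpan ℝ A := fun t =>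
    AffineMap.lineMap_mem t z.2 (subset_affineSpan ℝ A hy)
  let φ : ℝ → affineSpan ℝ A := fun t => ⟨AffineMap.lineMap (z : E) y t, hmem t⟩
  have hφ : Continuous φ := AffineMap.lineMap_continuous.subtype_mk hmem
  have h0 : φ 0 = z := by ext; simp [φ]
  have hev : ∀ᶠ t in nhds (0 : ℝ), φ t ∈ interior ((↑) ⁻¹' A : Set (affineSpan ℝ A)) :=
    hφ.continuousAt.eventually_mem (by rw [h0]; exact isOpen_interior.mem_nhds hz)
  have hev' : ∀ᶠ t in nhdsWithin (0 : ℝ) (Set.Iio 0),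
      φ t ∈ interior ((↑) ⁻¹' A : Set (affineSpan ℝ A)) := hev.filter_mono nhdsWithin_le_nhds
  -- A negative parameter moves past the interior point, away from `y`; there `f` would exceed its
  -- maximum if `f y` were smaller.
  obtain ⟨t, ht, ht0⟩ := (hev'.and self_mem_nhdsWithin).exists
  have h1 := hf (φ t) (interior_subset ht : φ t ∈ ((↑) ⁻¹' A : Set (affineSpan ℝ A)))
  have ht0 : t < 0 := ht0
  simp only [φ, AffineMap.lineMap_apply, vsub_eq_sub, vadd_eq_add, map_add, map_smul, map_sub,
    smul_eq_mul] at h1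
  nlinarith

theorem intrinsicInterior_eq_of_affineSpan_eq {A : Set E} {Q : AffineSubspace ℝ E}
    (h : affineSpan ℝ A = Q) :
    intrinsicInterior ℝ A = (↑) '' interior ((↑) ⁻¹' A : Set Q) := by
  subst h; rfl

/-- Two convex sets with the same affine span and disjoint intrinsic interiors are separated by a
hyperplane which does not contain the first of them. -/
theorem exists_proper_separation [FiniteDimensional ℝ E]
    {S T : Set E} (hS : Convex ℝ S) (hT : Convex ℝ T)
    (hSne : S.Nonempty) (hTne : T.Nonempty) (hspan : affineSpan ℝ S = affineSpan ℝ T)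
    (hd : Disjoint (intrinsicInterior ℝ S) (intrinsicInterior ℝ T)) :
    ∃ (f : StrongDual ℝ E) (c : ℝ), (∀ x ∈ S, f x ≤ c) ∧ (∀ x ∈ T, c ≤ f x) ∧
      ∃ y ∈ S, f y ≠ c := by
  obtain ⟨p, hp⟩ := hSne
  obtain ⟨Q, hQ⟩ : ∃ Q, Q = affineSpan ℝ S := ⟨_, rfl⟩
  have hpQ : p ∈ Q := hQ ▸ subset_affineSpan ℝ S hp
  have : Nonempty Q := ⟨⟨p, hpQ⟩⟩
  -- Intrinsic interiors become ordinary interiors in the direction space of the common span, where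
  -- Hahn–Banach applies; the functional is then extended to `E`.
  let φ : Q.direction ≃ᵃⁱ[ℝ] Q := AffineIsometryEquiv.vaddConst ℝ (⟨p, hpQ⟩ : Q)
  have key : ∀ A : Set E, Convex ℝ A → A.Nonempty → affineSpan ℝ A = Q →
      Convex ℝ (φ ⁻¹' ((↑) ⁻¹' A : Set Q)) ∧ (interior (φ ⁻¹' ((↑) ⁻¹' A : Set Q))).Nonempty ∧
      ∀ v ∈ interior (φ ⁻¹' ((↑) ⁻¹' A : Set Q)), (φ v : E) ∈ intrinsicInterior ℝ A := by
    intro A hA hAne hAQ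
    have hint : interior (φ ⁻¹' ((↑) ⁻¹' A : Set Q)) = φ ⁻¹' (interior ((↑) ⁻¹' A : Set Q)) :=
      (φ.toHomeomorph.preimage_interior _).symm
    refine ⟨?_, ?_, ?_⟩
    · exact hA.affine_preimage (Q.subtype.comp φ.toAffineEquiv.toAffineMap)
    · obtain ⟨x, hx⟩ := Set.Nonempty.intrinsicInterior hA hAne
      rw [intrinsicInterior_eq_of_affineSpan_eq hAQ] at hx
      obtain ⟨z, hz, rfl⟩ := hx
      refine ⟨φ.symm z, ?_⟩
      rw [hint]
      simpa using hz
    · intro v hv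
      rw [intrinsicInterior_eq_of_affineSpan_eq hAQ]
      rw [hint] at hv
      exact ⟨φ v, hv, rfl⟩
  obtain ⟨cS, neS, iS⟩ := key S hS ⟨p, hp⟩ hQ.symm
  obtain ⟨cT, neT, iT⟩ := key T hT hTne (hspan ▸ hQ.symm)
  obtain ⟨g, u, hgS, hgT⟩ := geometric_hahn_banach_open_open cS.interior isOpen_interior
    cT.interior isOpen_interior
    (Set.disjoint_left.2 fun v h1 h2 => Set.disjoint_left.1 hd (iS v h1) (iT v h2))
  obtain ⟨f, hf, -⟩ := exists_extension_norm_eq Q.direction g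
  have hφ : ∀ x (hx : x ∈ Q), f x = g (φ.symm ⟨x, hx⟩) + f p := by
    intro x hx
    rw [← hf]
    have : ((φ.symm ⟨x, hx⟩ : Q.direction) : E) = x - p := rfl
    rw [this, map_sub, sub_add_cancel]
  have hcl : ∀ A : Set E, Convex ℝ (φ ⁻¹' ((↑) ⁻¹' A : Set Q)) →
      (interior (φ ⁻¹' ((↑) ⁻¹' A : Set Q))).Nonempty → ∀ x (hx : x ∈ Q), x ∈ A →
      φ.symm ⟨x, hx⟩ ∈ closure (interior (φ ⁻¹' ((↑) ⁻¹' A : Set Q))) := by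
    intro A hA hAne x hx hxA
    rw [hA.closure_interior_eq_closure_of_nonempty_interior hAne]
    apply subset_closure
    simpa using hxA
  refine ⟨f, u + f p, ?_, ?_, ?_⟩
  · intro x hx
    have hxQ : x ∈ Q := hQ ▸ subset_affineSpan ℝ S hx
    rw [hφ x hxQ]
    have : g (φ.symm ⟨x, hxQ⟩) ≤ u :=
      closure_minimal (fun v hv => (hgS v hv).le : _ ⊆ {v | g v ≤ u})
        (isClosed_le g.continuous continuous_const) (hcl S cS neS x hxQ hx)
    linarith
  · intro x hx
    have hxQ : x ∈ Q := hQ ▸ hspan ▸ subset_affineSpan ℝ T hx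
    rw [hφ x hxQ]
    have : u ≤ g (φ.symm ⟨x, hxQ⟩) :=
      closure_minimal (fun v hv => (hgT v hv).le : _ ⊆ {v | u ≤ g v})
        (isClosed_le continuous_const g.continuous) (hcl T cT neT x hxQ hx)
    linarith
  · obtain ⟨v, hv⟩ := neS
    refine ⟨φ v, intrinsicInterior_subset (iS v hv), ?_⟩
    rw [hφ _ (φ v).2]
    have := hgS v hv
    have h2 : φ.symm ⟨φ v, (φ v).2⟩ = v := by simp
    rw [h2]
    exact fun h => this.ne (by linarith)

end General

/-! ### Regular subdivisions of a zonotope -/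

section RegularTiling

variable {E ι : Type*} [NormedAddCommGroup E] [NormedSpace ℝ E]

/-- The points `t` of the unit cube minimizing `∑ tᵢ (hᵢ - w aᵢ)`. -/
def IsCompatible (a : ι → E) (h : ι → ℝ) (w : StrongDual ℝ E) (t : ι → ℝ) : Prop :=
  ∀ i, 0 ≤ t i ∧ t i ≤ 1 ∧ (h i < w (a i) → t i = 1) ∧ (w (a i) < h i → t i = 0)

/-- Complementary slackness: the objective is a sum over coordinates, so leaving a minimizer costs a
nonnegative amount in each of them, and stays optimal only if every amount is zero. -/
theorem isCompatible_iff {a : ι → E} {h : ι → ℝ} {w : StrongDual ℝ E} {t s : ι → ℝ}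
    (ht : IsCompatible a h w t) (hs : ∀ i, 0 ≤ s i ∧ s i ≤ 1) :
    (∀ i, 0 ≤ (s i - t i) * (h i - w (a i))) ∧
      (IsCompatible a h w s ↔ ∀ i, (s i - t i) * (h i - w (a i)) = 0) := by
  refine ⟨fun i => ?_, fun hc i => ?_, fun hz i => ⟨(hs i).1, (hs i).2, fun hi => ?_, fun hi => ?_⟩⟩
  · obtain ⟨_, _, h1, h0⟩ := ht i
    obtain ⟨_, _⟩ := hs i
    rcases lt_trichotomy (h i) (w (a i)) with hi | hi | hi
    · rw [h1 hi]; nlinarith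
    · rw [hi]; simp
    · rw [h0 hi]; nlinarith
  · obtain ⟨_, _, h1, h0⟩ := ht i
    obtain ⟨_, _, s1, s0⟩ := hc i
    rcases lt_trichotomy (h i) (w (a i)) with hi | hi | hi
    · rw [h1 hi, s1 hi]; simp
    · rw [hi]; simp
    · rw [h0 hi, s0 hi]; simp
  · rw [← (ht i).2.2.1 hi]
    rcases mul_eq_zero.1 (hz i) with h1 | h1 <;> linarith
  · rw [← (ht i).2.2.2 hi]
    rcases mul_eq_zero.1 (hz i) with h1 | h1 <;> linarith

theorem IsCompatible.bounds {a : ι → E} {h : ι → ℝ} {w : StrongDual ℝ E} {t : ι → ℝ}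
    (ht : IsCompatible a h w t) : ∀ i, 0 ≤ t i ∧ t i ≤ 1 := fun i => ⟨(ht i).1, (ht i).2.1⟩

variable [Fintype ι]

/-- The tile of the regular subdivision of `parallelepiped a` with heights `h` that is selected by
the functional `w`. -/
def liftTile (a : ι → E) (h : ι → ℝ) (w : StrongDual ℝ E) : Set E :=
  (fun t : ι → ℝ => ∑ i, t i • a i) '' {t | IsCompatible a h w t}

/-- Coefficient vectors of a common point of two tiles are compatible with both functionals. -/
theorem IsCompatible.of_sum_eq {a : ι → E} {h : ι → ℝ} {w w' : StrongDual ℝ E} {t s : ι → ℝ}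
    (ht : IsCompatible a h w t) (hs : IsCompatible a h w' s)
    (heq : ∑ i, t i • a i = ∑ i, s i • a i) : IsCompatible a h w s := by
  -- Both vectors represent the same point, so the functional drops out of the cost difference;
  -- optimality for `w` and for `w'` then bounds it from both sides.
  have key : ∀ v : StrongDual ℝ E,
      ∑ i, (s i - t i) * (h i - v (a i)) = ∑ i, (s i - t i) * h i := by
    intro v
    have := congrArg v heq
    simp only [map_sum, map_smul, smul_eq_mul] at this
    simp only [mul_sub, sub_mul, Finset.sum_sub_distrib] at *
    linarith
  obtain ⟨p1, q1⟩ := isCompatible_iff ht hs.bounds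
  obtain ⟨p2, -⟩ := isCompatible_iff hs ht.bounds
  have h1 : 0 ≤ ∑ i, (s i - t i) * h i := by
    rw [← key w]; exact Finset.sum_nonneg fun i _ => p1 i
  have h2 : 0 ≤ -∑ i, (s i - t i) * h i := by
    rw [← key w', ← Finset.sum_neg_distrib]
    exact Finset.sum_nonneg fun i _ => by linarith [p2 i]
  have h3 : ∑ i, (s i - t i) * (h i - w (a i)) = 0 := by rw [key]; linarith
  exact q1.2 fun i => (Finset.sum_eq_zero_iff_of_nonneg fun i _ => p1 i).1 h3 i (Finset.mem_univ i)

/-- The intersection of two tiles is the face of the first one exposed by the difference of the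
functionals. -/
theorem liftTile_inter_eq {a : ι → E} {h : ι → ℝ} {w w' : StrongDual ℝ E}
    (hne : (liftTile a h w ∩ liftTile a h w').Nonempty) :
    liftTile a h w ∩ liftTile a h w' = (w' - w).toExposed (liftTile a h w) := by
  -- On the tile of `w`, the loss in `w' - w` relative to a common point is exactly the excess cost
  -- for `w'`, so maximality means compatibility with `w'`.
  have hle : ∀ {t s : ι → ℝ}, IsCompatible a h w t → IsCompatible a h w' t → IsCompatible a h w s →
      ((w' - w) (∑ i, t i • a i) - (w' - w) (∑ i, s i • a i) =
        ∑ i, (s i - t i) * (h i - w' (a i))) := by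
    intro t s ht ht' hs
    have h0 := (isCompatible_iff ht hs.bounds).2.1 hs
    rw [← sub_eq_zero, map_sum, map_sum, ← Finset.sum_sub_distrib, ← Finset.sum_sub_distrib]
    refine Finset.sum_eq_zero fun i _ => ?_
    have := h0 i
    simp only [map_smul, sub_apply, smul_eq_mul]
    linarith
  obtain ⟨x, ⟨t, ht, rfl⟩, ⟨t', ht', hx⟩⟩ := hne
  have htt : IsCompatible a h w' t := IsCompatible.of_sum_eq ht' ht hx
  ext y
  constructor
  · rintro ⟨⟨s, hs, rfl⟩, ⟨s', hs', hy⟩⟩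
    refine ⟨⟨s, hs, rfl⟩, ?_⟩
    have hss : IsCompatible a h w' s := IsCompatible.of_sum_eq hs' hs hy
    rintro _ ⟨r, hr, rfl⟩
    rw [← sub_nonneg]
    dsimp only
    rw [hle hs hss hr]
    exact Finset.sum_nonneg fun i _ => (isCompatible_iff hss hr.bounds).1 i
  · rintro ⟨⟨s, hs, rfl⟩, hmax⟩
    refine ⟨⟨s, hs, rfl⟩, ⟨s, ?_, rfl⟩⟩
    obtain ⟨p, q⟩ := isCompatible_iff htt hs.bounds
    have h1 := hmax _ ⟨t, ht, rfl⟩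
    rw [← sub_nonpos] at h1
    dsimp only at h1
    rw [hle ht htt hs] at h1
    have h2 := le_antisymm h1 (Finset.sum_nonneg fun i _ => p i)
    exact q.2 fun i => (Finset.sum_eq_zero_iff_of_nonneg fun i _ => p i).1 h2 i (Finset.mem_univ i)

/-- A tile is a translate of the parallelepiped of its active generators. -/
theorem liftTile_eq_vadd (a : ι → E) (h : ι → ℝ) (w : StrongDual ℝ E) :
    ∃ c : E, liftTile a h w = c +ᵥ parallelepiped (fun i : {i // w (a i) = h i} => a i) := by
  classical
  refine ⟨∑ i, (if h i < w (a i) then (1 : ℝ) else 0) • a i, ?_⟩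
  have hsum : ∀ t : ι → ℝ, IsCompatible a h w t → ∑ i, t i • a i =
      ∑ i, (if h i < w (a i) then (1 : ℝ) else 0) • a i +
        ∑ i : {i // w (a i) = h i}, t i • a i := by
    intro t ht
    rw [show ∑ i : {i // w (a i) = h i}, t i • a i =
        ∑ i, if w (a i) = h i then t i • a i else 0 by
      rw [← Finset.sum_filter]
      exact (Finset.sum_subtype _ (by simp) fun i => t i • a i).symm, ← Finset.sum_add_distrib]
    refine Finset.sum_congr rfl fun i _ => ?_
    obtain ⟨-, -, t1, t0⟩ := ht i
    rcases lt_trichotomy (h i) (w (a i)) with hi | hi | hi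
    · simp [hi, hi.ne', t1 hi]
    · simp [hi]
    · simp [hi.ne, hi.not_gt, t0 hi]
  ext x
  simp only [liftTile, Set.mem_image, Set.mem_ofPred_eq, Set.mem_vadd_set, mem_parallelepiped_iff,
    vadd_eq_add]
  constructor
  · rintro ⟨t, ht, rfl⟩
    exact ⟨_, ⟨fun i => t i, ⟨fun i => (ht i).1, fun i => (ht i).2.1⟩, rfl⟩, (hsum t ht).symm⟩
  · rintro ⟨_, ⟨r, ⟨hr0, hr1⟩, rfl⟩, rfl⟩
    let t : ι → ℝ := fun i =>
      if hi : w (a i) = h i then r ⟨i, hi⟩ else if h i < w (a i) then 1 else 0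
    have ht : IsCompatible a h w t := by
      intro i
      by_cases hi : w (a i) = h i
      · simp only [t, hi, dif_pos]
        exact ⟨hr0 _, hr1 _, fun h => absurd h (lt_irrefl _), fun h => absurd h (lt_irrefl _)⟩
      · simp only [t, dif_neg hi]
        split_ifs with h2
        · exact ⟨zero_le_one, le_rfl, fun _ => rfl, fun h3 => absurd h2 h3.not_gt⟩
        · exact ⟨le_rfl, zero_le_one, fun h3 => absurd h3 h2, fun _ => rfl⟩
    refine ⟨t, ht, ?_⟩
    rw [hsum t ht]
    congr 1
    exact Finset.sum_congr rfl fun i _ => by simp [t, i.2]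

/-- The convex, piecewise linear function whose subdifferential contains `0` at `w` exactly if `x`
lies in the tile of `w`. -/
def dualGap (a : ι → E) (h : ι → ℝ) (x : E) (w : StrongDual ℝ E) : ℝ :=
  ∑ i, max (w (a i) - h i) 0 - w x

/-- The same slopes `t` linearize the positive parts at both functionals, so the difference is
linear. -/
theorem dualGap_sub {a : ι → E} {h : ι → ℝ} {x : E} {w w' : StrongDual ℝ E} {t : ι → ℝ}
    (h1 : ∀ i, max (w (a i) - h i) 0 = t i * (w (a i) - h i))
    (h2 : ∀ i, max (w' (a i) - h i) 0 = t i * (w' (a i) - h i)) :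
    dualGap a h x w' - dualGap a h x w = (w' - w) (∑ i, t i • a i) - (w' - w) x := by
  simp only [dualGap, h1, h2, map_sum, map_smul, sub_apply, smul_eq_mul]
  rw [show ∀ p q r s : ℝ, p - q - (r - s) = (p - r) - (q - s) by intros; ring,
    ← Finset.sum_sub_distrib]
  congr 1
  exact Finset.sum_congr rfl fun i _ => by ring

/-- Along a direction that keeps the active generators active, does not increase `dualGap` to first
order and meets a further wall, `dualGap` does not increase until the first wall. -/
theorem exists_dualGap_le_of_direction {a : ι → E} {h : ι → ℝ} {x : E} {w d : StrongDual ℝ E}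
    (hd : ∀ i, w (a i) = h i → d (a i) = 0)
    (hslope : ∑ i, (if h i < w (a i) then (1 : ℝ) else 0) * d (a i) ≤ d x)
    (hwall : ∃ i, w (a i) ≠ h i ∧ ∃ τ : ℝ, 0 < τ ∧ w (a i) + τ * d (a i) = h i) :
    ∃ w', {i | w (a i) = h i} ⊂ {i | w' (a i) = h i} ∧
      dualGap a h x w' ≤ dualGap a h x w := by
  classical
  let F : Finset ι := Finset.univ.filter fun i =>
    w (a i) ≠ h i ∧ ∃ τ : ℝ, 0 < τ ∧ w (a i) + τ * d (a i) = h i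
  have hF : F.Nonempty := by
    obtain ⟨i, hi⟩ := hwall
    exact ⟨i, by simpa [F] using hi⟩
  -- The wall reached first, at time `τ` below. No inactive generator changes sign before `τ`, so
  -- `dualGap` is affine up to there.
  obtain ⟨i, hiF, hmin⟩ := F.exists_min_image (fun i => (h i - w (a i)) / d (a i)) hF
  obtain ⟨hi, τ, hτ, hτi⟩ : w (a i) ≠ h i ∧ ∃ τ : ℝ, 0 < τ ∧ w (a i) + τ * d (a i) = h i := by
    simpa [F] using hiF
  have hdi : ∀ j, w (a j) ≠ h j → ∀ σ : ℝ, w (a j) + σ * d (a j) = h j →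
      (h j - w (a j)) / d (a j) = σ := by
    intro j hj σ hσ
    have hne : d (a j) ≠ 0 := fun h0 => hj (by simpa [h0] using hσ)
    rw [div_eq_iff hne]; linarith
  have hfirst : ∀ j, w (a j) ≠ h j → ∀ σ : ℝ, 0 < σ → w (a j) + σ * d (a j) = h j → τ ≤ σ := by
    intro j hj σ hσ hσj
    have := hmin j (by simpa [F] using ⟨hj, σ, hσ, hσj⟩)
    rwa [hdi i hi τ hτi, hdi j hj σ hσj] at this
  have hpos : ∀ j, h j < w (a j) → h j ≤ w (a j) + τ * d (a j) := by
    intro j hj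
    by_contra! hlt
    have hdn : d (a j) < 0 := by nlinarith
    have := hfirst j hj.ne' ((w (a j) - h j) / (-d (a j)))
      (div_pos (by linarith) (by linarith)) (by have := hdn.ne; field_simp; ring)
    rw [le_div_iff₀ (by linarith)] at this
    linarith
  have hneg : ∀ j, w (a j) < h j → w (a j) + τ * d (a j) ≤ h j := by
    intro j hj
    by_contra! hlt
    have hdn : 0 < d (a j) := by nlinarith
    have := hfirst j hj.ne ((h j - w (a j)) / d (a j))
      (div_pos (by linarith) hdn) (by field_simp; ring)
    rw [le_div_iff₀ hdn] at this
    linarith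
  refine ⟨w + τ • d, ?_, ?_⟩
  · rw [Set.ssubset_iff_of_subset]
    · exact ⟨i, by simpa using hτi, hi⟩
    · intro j hj
      have hj : w (a j) = h j := hj
      simp [hj, hd j hj]
  · rw [← sub_nonpos, dualGap_sub (t := fun i => if h i < w (a i) then 1 else 0)]
    · simp only [add_sub_cancel_left, smul_apply, smul_eq_mul, map_sum,
        map_smul]
      have h1 := mul_le_mul_of_nonneg_left hslope hτ.le
      rw [Finset.mul_sum] at h1
      simp only [mul_left_comm τ] at h1
      linarith
    · intro j
      split_ifs with hj
      · rw [max_eq_left (by linarith), one_mul]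
      · rw [max_eq_right (by linarith), zero_mul]
    · intro j
      simp only [add_apply, smul_apply, smul_eq_mul]
      split_ifs with hj
      · rw [max_eq_left (by linarith [hpos j hj]), one_mul]
      · rw [zero_mul]
        rcases (not_lt.1 hj).eq_or_lt with hj' | hj'
        · simp [hj', hd j hj']
        · exact max_eq_right (by linarith [hneg j hj'])

/-- Generic heights make the active generators of every functional linearly independent. -/
theorem exists_generic_heights (a : ι → E) : ∃ h : ι → ℝ, ∀ w : StrongDual ℝ E,
    LinearIndependent ℝ fun i : {i // w (a i) = h i} => a i := by
  classical
  let D : Type _ := {S : Set ι // ¬ LinearIndependent ℝ fun i : S => a i}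
  have hdep : ∀ S : D, ∃ g : ι → ℝ, (∀ i ∉ S.1, g i = 0) ∧ ∑ i, g i • a i = 0 ∧
      ∃ i, g i ≠ 0 := by
    intro S
    obtain ⟨g, hg, i, hi⟩ := Fintype.not_linearIndependent_iff.1 S.2
    refine ⟨fun i => if hi : i ∈ S.1 then g ⟨i, hi⟩ else 0, fun i hi => dif_neg hi, ?_, i, ?_⟩
    · rw [← hg, ← Finset.sum_subset (Finset.subset_univ (Finset.univ.filter fun i => i ∈ S.1)),
        Finset.sum_subtype (p := fun i => i ∈ S.1) _ (by simp)]
      · exact Finset.sum_congr rfl fun i _ => by simp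
      · intro i _ hi
        have : i ∉ S.1 := by simpa using hi
        simp [this]
    · simpa using hi
  choose g hgS hga hgne using hdep
  -- The heights avoid the hyperplane `∑ gᵢ hᵢ = 0` of every chosen dependence relation. If a
  -- dependent set were active for `w`, applying `w` to its relation would put `h` on that
  -- hyperplane.
  obtain ⟨h, hh⟩ := Module.Dual.exists_forall_ne_zero_of_forall_exists (K := ℝ) (M := ι → ℝ)
    (fun S : D => ∑ i, g S i • (LinearMap.proj i : (ι → ℝ) →ₗ[ℝ] ℝ)) (by
      intro S
      obtain ⟨i, hi⟩ := hgne S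
      refine ⟨Pi.single i 1, ?_⟩
      simpa [Pi.single_apply] using hi)
  refine ⟨h, fun w => ?_⟩
  by_contra hw
  let S : D := ⟨{i | w (a i) = h i}, hw⟩
  apply hh S
  have h0 := congrArg w (hga S)
  simp only [map_sum, map_smul, smul_eq_mul, map_zero] at h0
  simp only [LinearMap.sum_apply, LinearMap.smul_apply, LinearMap.proj_apply, smul_eq_mul]
  rw [← h0]
  refine Finset.sum_congr rfl fun i _ => ?_
  by_cases hi : w (a i) = h i
  · rw [hi]
  · rw [hgS S i hi, zero_mul, zero_mul]

variable [FiniteDimensional ℝ E]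

/-- Some direction kills the active generators but not all generators, and it or its negative has
nonpositive slope. Since `x` lies in the zonotope, a ray meeting no wall cannot have negative slope,
so a usable ray meeting a wall exists. -/
theorem exists_dualGap_le_of_span_ne {a : ι → E} {h : ι → ℝ} {x : E} (hx : x ∈ parallelepiped a)
    {w : StrongDual ℝ E}
    (hw : Submodule.span ℝ (a '' {i | w (a i) = h i}) ≠ Submodule.span ℝ (Set.range a)) :
    ∃ w', {i | w (a i) = h i} ⊂ {i | w' (a i) = h i} ∧
      dualGap a h x w' ≤ dualGap a h x w := by
  classical
  obtain ⟨j, hj⟩ : ∃ j, a j ∉ Submodule.span ℝ (a '' {i | w (a i) = h i}) := by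
    by_contra! hall
    refine hw (le_antisymm (Submodule.span_mono (Set.image_subset_range _ _))
      (Submodule.span_le.2 ?_))
    rintro _ ⟨i, rfl⟩
    exact hall i
  obtain ⟨d, hd0, hdj⟩ := exists_strongDual_ne_zero_of_notMem hj
  have hd : ∀ i, w (a i) = h i → d (a i) = 0 := fun i hi =>
    hd0 _ (Submodule.subset_span ⟨i, hi, rfl⟩)
  have hwj : w (a j) ≠ h j := fun h0 => hdj (hd j h0)
  by_contra hcon
  have hno : ∀ e : StrongDual ℝ E, (∀ i, w (a i) = h i → e (a i) = 0) →
      ∑ i, (if h i < w (a i) then (1 : ℝ) else 0) * e (a i) ≤ e x →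
      ∀ i, w (a i) ≠ h i → ∀ τ : ℝ, 0 < τ → w (a i) + τ * e (a i) ≠ h i :=
    fun e he hs i hi τ hτ hτi =>
      hcon (exists_dualGap_le_of_direction he hs ⟨i, hi, τ, hτ, hτi⟩)
  obtain ⟨t, ⟨ht0, ht1⟩, hxt⟩ := (mem_parallelepiped_iff _ _).1 hx
  -- a direction meeting no wall has nonnegative slope
  have hge : ∀ e : StrongDual ℝ E, (∀ i, w (a i) = h i → e (a i) = 0) →
      (∀ i, w (a i) ≠ h i → ∀ τ : ℝ, 0 < τ → w (a i) + τ * e (a i) ≠ h i) →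
      e x ≤ ∑ i, (if h i < w (a i) then (1 : ℝ) else 0) * e (a i) := by
    intro e he hn
    rw [hxt, map_sum]
    refine Finset.sum_le_sum fun i _ => ?_
    rw [map_smul, smul_eq_mul]
    have h0 : 0 ≤ t i := ht0 i
    have h1 : t i ≤ 1 := ht1 i
    rcases lt_trichotomy (h i) (w (a i)) with hi | hi | hi
    · rw [if_pos hi]
      have : 0 ≤ e (a i) := by
        by_contra! hlt
        exact hn i hi.ne' ((w (a i) - h i) / (-e (a i))) (div_pos (by linarith) (by linarith))
          (by have := hlt.ne; field_simp; ring)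
      nlinarith
    · simp [he i hi.symm]
    · rw [if_neg hi.not_gt]
      have : e (a i) ≤ 0 := by
        by_contra! hlt
        exact hn i hi.ne ((h i - w (a i)) / e (a i)) (div_pos (by linarith) hlt)
          (by field_simp; ring)
      nlinarith
  -- If `e` met no wall its slope would be zero, making `-e` equally usable; but the wall of `a j`
  -- lies on one of the two rays.
  have main : ∀ e : StrongDual ℝ E, (∀ i, w (a i) = h i → e (a i) = 0) → e (a j) ≠ 0 →
      ∑ i, (if h i < w (a i) then (1 : ℝ) else 0) * e (a i) ≤ e x → False := by
    intro e he hej hs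
    have hn := hno e he hs
    have heq := le_antisymm hs (hge e he hn)
    have hn' := hno (-e) (fun i hi => by simp [he i hi]) (by simpa using heq.ge)
    have hne : (h j - w (a j)) / e (a j) ≠ 0 := div_ne_zero (sub_ne_zero.2 hwj.symm) hej
    rcases hne.lt_or_gt with hlt | hlt
    · exact hn' j hwj (-((h j - w (a j)) / e (a j))) (by linarith) (by simp; field_simp; ring)
    · exact hn j hwj _ hlt (by field_simp; ring)
  rcases le_total (∑ i, (if h i < w (a i) then (1 : ℝ) else 0) * d (a i)) (d x) with hs | hs
  · exact main d hd hdj hs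
  · exact main (-d) (fun i hi => by simp [hd i hi]) (by simpa using hdj) (by simpa using hs)

theorem exists_spanning_dualGap_le {a : ι → E} {h : ι → ℝ} {x : E} (hx : x ∈ parallelepiped a)
    (w : StrongDual ℝ E) :
    ∃ w', Submodule.span ℝ (a '' {i | w' (a i) = h i}) = Submodule.span ℝ (Set.range a) ∧
      dualGap a h x w' ≤ dualGap a h x w := by
  classical
  induction hS : {i | w (a i) = h i} using WellFoundedGT.induction generalizing w with
  | ind S ih =>
    by_cases hw : Submodule.span ℝ (a '' {i | w (a i) = h i}) = Submodule.span ℝ (Set.range a)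
    · exact ⟨w, hw, le_rfl⟩
    · obtain ⟨w₁, h1, h2⟩ := exists_dualGap_le_of_span_ne hx hw
      obtain ⟨w₂, h3, h4⟩ := ih _ (hS ▸ h1) w₁ rfl
      exact ⟨w₂, h3, h4.trans h2⟩

/-- The spanning tiles cover the parallelepiped. -/
theorem exists_mem_liftTile {a : ι → E} (h : ι → ℝ) {x : E} (hx : x ∈ parallelepiped a) :
    ∃ w : StrongDual ℝ E,
      Submodule.span ℝ (a '' {i | w (a i) = h i}) = Submodule.span ℝ (Set.range a) ∧
      x ∈ liftTile a h w := by
  classical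
  let B : Set (StrongDual ℝ E) :=
    {w | Submodule.span ℝ (a '' {i | w (a i) = h i}) = Submodule.span ℝ (Set.range a)}
  have hxs : x ∈ Submodule.span ℝ (Set.range a) := by
    obtain ⟨t, -, rfl⟩ := (mem_parallelepiped_iff _ _).1 hx
    exact Submodule.sum_mem _ fun i _ => Submodule.smul_mem _ _ (Submodule.subset_span ⟨i, rfl⟩)
  -- Among spanning functionals the value depends only on the active set, so finitely many values
  -- occur and a minimum over `B` exists; by the descent it is a global minimum.
  have hBeq : ∀ w ∈ B, ∀ w' ∈ B, {i | w (a i) = h i} = {i | w' (a i) = h i} →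
      dualGap a h x w = dualGap a h x w' := by
    intro w hw w' _ hww
    have hon : ∀ y ∈ Submodule.span ℝ (Set.range a), w y = w' y := by
      intro y hy
      rw [← (show _ = _ from hw)] at hy
      refine LinearMap.eqOn_span (f := (w : E →ₗ[ℝ] ℝ)) (g := (w' : E →ₗ[ℝ] ℝ)) ?_ hy
      rintro _ ⟨i, hi, rfl⟩
      have hi' : i ∈ {i | w' (a i) = h i} := hww ▸ hi
      exact (show w (a i) = h i from hi).trans (show w' (a i) = h i from hi').symm
    simp only [dualGap, hon x hxs, fun i => hon (a i) (Submodule.subset_span ⟨i, rfl⟩)]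
  have hfin : (dualGap a h x '' B).Finite := by
    let g : Set ι → ℝ := fun S =>
      if hS : ∃ w ∈ B, {i | w (a i) = h i} = S then dualGap a h x hS.choose else 0
    refine (Set.finite_range g).subset ?_
    rintro _ ⟨w, hw, rfl⟩
    have hex : ∃ w₁ ∈ B, {i | w₁ (a i) = h i} = {i | w (a i) = h i} := ⟨w, hw, rfl⟩
    refine ⟨{i | w (a i) = h i}, ?_⟩
    simp only [g]
    rw [dif_pos hex]
    exact hBeq _ hex.choose_spec.1 _ hw hex.choose_spec.2
  have hne : (dualGap a h x '' B).Nonempty := by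
    obtain ⟨w, hw, -⟩ := exists_spanning_dualGap_le (h := h) hx 0
    exact ⟨_, w, hw, rfl⟩
  obtain ⟨_, ⟨w, hw, rfl⟩, hmin⟩ := Set.exists_min_image _ id hfin hne
  have hle : ∀ w', dualGap a h x w ≤ dualGap a h x w' := by
    intro w'
    obtain ⟨w₁, h1, h2⟩ := exists_spanning_dualGap_le (h := h) hx w'
    exact (hmin _ ⟨w₁, h1, rfl⟩).trans h2
  refine ⟨w, hw, ?_⟩
  by_contra hxT
  obtain ⟨c, hc⟩ := liftTile_eq_vadd a h w
  have hconv : Convex ℝ (liftTile a h w) := hc ▸ (convex_parallelepiped _).vadd c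
  have hcomp : IsCompact (liftTile a h w) := by
    rw [hc]
    refine (IsCompact.image isCompact_Icc ?_).vadd c
    fun_prop
  obtain ⟨d, u, hdu, hux⟩ := geometric_hahn_banach_closed_point hconv hcomp.isClosed hxT
  -- The corner of the tile maximizing `d`. It also gives the slopes of `dualGap` just beyond `w` in
  -- direction `d`, so strict separation would make `dualGap` drop below its minimum.
  let t : ι → ℝ := fun i => if h i < w (a i) ∨ (w (a i) = h i ∧ 0 < d (a i)) then 1 else 0
  have ht : IsCompatible a h w t := by
    intro i
    simp only [t]
    split_ifs with hi
    · refine ⟨zero_le_one, le_rfl, fun _ => rfl, fun h2 => ?_⟩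
      rcases hi with hi | hi <;> linarith
    · exact ⟨le_rfl, zero_le_one, fun h2 => absurd (Or.inl h2) hi, fun _ => rfl⟩
  have hlt : d (∑ i, t i • a i) < d x := (hdu _ ⟨t, ht, rfl⟩).trans hux
  have hev : ∀ᶠ ε in nhdsWithin (0 : ℝ) (Set.Ioi 0), ∀ i, w (a i) ≠ h i →
      (h i < w (a i) ↔ h i < w (a i) + ε * d (a i)) := by
    rw [Filter.eventually_all]
    intro i
    have hcont : Filter.Tendsto (fun ε : ℝ => w (a i) + ε * d (a i)) (nhds 0)
        (nhds (w (a i))) := by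
      have : Continuous fun ε : ℝ => w (a i) + ε * d (a i) := by fun_prop
      simpa using this.tendsto 0
    by_cases hi : w (a i) = h i
    · exact Filter.Eventually.of_forall fun _ h0 => absurd hi h0
    rcases lt_or_gt_of_ne hi with hi | hi
    · filter_upwards [(hcont.eventually_lt_const hi).filter_mono nhdsWithin_le_nhds] with ε hε _
      exact ⟨fun h2 => absurd hi h2.not_gt, fun h2 => absurd hε h2.not_gt⟩
    · filter_upwards [(hcont.eventually_const_lt hi).filter_mono nhdsWithin_le_nhds] with ε hε _
      exact ⟨fun _ => hε, fun _ => hi⟩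
  obtain ⟨ε, hε, hε0⟩ := (hev.and self_mem_nhdsWithin).exists
  have hε0 : 0 < ε := hε0
  have hgap := dualGap_sub (a := a) (h := h) (x := x) (w := w) (w' := w + ε • d) (t := t) ?_ ?_
  · have := hle (w + ε • d)
    simp only [add_sub_cancel_left, smul_apply, smul_eq_mul] at hgap
    nlinarith
  · intro i
    simp only [t]
    split_ifs with hi
    · rw [max_eq_left, one_mul]
      rcases hi with hi | hi <;> linarith
    · rw [max_eq_right, zero_mul]
      by_contra! h2
      exact hi (Or.inl (by linarith))
  · intro i
    simp only [t, add_apply, smul_apply, smul_eq_mul]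
    by_cases hi : w (a i) = h i
    · simp only [hi, lt_irrefl, true_and, false_or, add_sub_cancel_left]
      split_ifs with hd
      · rw [max_eq_left (by positivity), one_mul]
      · rw [max_eq_right (mul_nonpos_of_nonneg_of_nonpos hε0.le (not_lt.1 hd)), zero_mul]
    · simp only [hi, false_and, or_false]
      have h2 := hε i hi
      split_ifs with h3
      · rw [max_eq_left (by linarith [h2.1 h3]), one_mul]
      · rw [max_eq_right (by linarith [not_lt.1 (mt h2.2 h3)]), zero_mul]

end RegularTiling

/-! ### Tiling a zonotope by parallelotopes -/

section Zonotope

variable {E ι : Type*} [NormedAddCommGroup E] [NormedSpace ℝ E] [Fintype ι]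

theorem affineSpan_vadd_parallelepiped (c : E) (a : ι → E) :
    affineSpan ℝ (c +ᵥ parallelepiped a) = AffineSubspace.mk' c (Submodule.span ℝ (Set.range a)) := by
  classical
  have hc : c ∈ c +ᵥ parallelepiped a := by
    refine ⟨0, (mem_parallelepiped_iff _ _).2 ⟨0, ⟨le_rfl, zero_le_one⟩, by simp⟩, by simp⟩
  apply le_antisymm
  · refine affineSpan_le.2 ?_
    rintro _ ⟨x, hx, rfl⟩
    obtain ⟨t, -, rfl⟩ := (mem_parallelepiped_iff _ _).1 hx
    rw [SetLike.mem_coe, AffineSubspace.mem_mk']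
    simp only [vadd_eq_add, vsub_eq_sub, add_sub_cancel_left]
    exact Submodule.sum_mem _ fun i _ => Submodule.smul_mem _ _ (Submodule.subset_span ⟨i, rfl⟩)
  · have hc' := subset_affineSpan ℝ _ hc
    rw [← AffineSubspace.mk'_eq hc']
    intro x hx
    rw [AffineSubspace.mem_mk'] at hx ⊢
    refine (Submodule.span_le.2 ?_ : Submodule.span ℝ (Set.range a) ≤ _) hx
    rintro _ ⟨i, rfl⟩
    have hi : c + a i ∈ affineSpan ℝ (c +ᵥ parallelepiped a) := by
      apply subset_affineSpan
      refine ⟨a i, (mem_parallelepiped_iff _ _).2 ⟨Pi.single i 1, ⟨?_, ?_⟩, ?_⟩, rfl⟩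
      · exact Pi.single_nonneg.2 zero_le_one
      · intro j
        by_cases h : j = i
        · subst h; simp
        · simp [h]
      · simp [Pi.single_apply, ite_smul]
    simpa using AffineSubspace.vsub_mem_direction hi hc'

theorem isCompact_parallelepiped (a : ι → E) : IsCompact (parallelepiped a) :=
  IsCompact.image isCompact_Icc (by fun_prop)

theorem isZonotope_vadd_parallelepiped {n : ℕ} (c : EuclideanSpace ℝ (Fin n))
    (a : ι → EuclideanSpace ℝ (Fin n)) : IsZonotope (c +ᵥ parallelepiped a) := by
  refine ⟨c, Fintype.card ι, a ∘ (Fintype.equivFin ι).symm, ?_⟩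
  rw [parallelepiped_comp_equiv]

theorem isParallelotope_vadd_parallelepiped {n : ℕ} (c : EuclideanSpace ℝ (Fin n))
    {a : ι → EuclideanSpace ℝ (Fin n)} (ha : LinearIndependent ℝ a) :
    IsParallelotope (c +ᵥ parallelepiped a) := by
  refine ⟨c, Fintype.card ι, a ∘ (Fintype.equivFin ι).symm,
    ha.comp _ (Fintype.equivFin ι).symm.injective, ?_⟩
  rw [parallelepiped_comp_equiv]

theorem IsParallelotope.isZonotope {n : ℕ} {P : Set (EuclideanSpace ℝ (Fin n))}
    (hP : IsParallelotope P) : IsZonotope P := by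
  obtain ⟨c, k, a, -, h⟩ := hP
  exact ⟨c, k, a, h⟩

theorem liftTile_subset_parallelepiped {a : ι → E} {h : ι → ℝ}
    {w : StrongDual ℝ E} : liftTile a h w ⊆ parallelepiped a := by
  rintro _ ⟨t, ht, rfl⟩
  exact (mem_parallelepiped_iff _ _).2 ⟨t, ⟨fun i => (ht i).1, fun i => (ht i).2.1⟩, rfl⟩

theorem isExposed_vadd {A B : Set E} (c : E) (h : IsExposed ℝ A B) :
    IsExposed ℝ (c +ᵥ A) (c +ᵥ B) := by
  rintro ⟨_, b, hb, rfl⟩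
  obtain ⟨l, rfl⟩ := h ⟨b, hb⟩
  refine ⟨l, ?_⟩
  ext x
  constructor
  · rintro ⟨x, ⟨hx, hmax⟩, rfl⟩
    refine ⟨⟨x, hx, rfl⟩, ?_⟩
    rintro _ ⟨y, hy, rfl⟩
    simpa using hmax y hy
  · rintro ⟨⟨x, hx, rfl⟩, hmax⟩
    refine ⟨x, ⟨hx, fun y hy => ?_⟩, rfl⟩
    simpa using hmax _ ⟨y, hy, rfl⟩

/-- Every zonotope has a face-to-face tiling by parallelotopes. -/
theorem IsZonotope.decomposesFaceToFace {n : ℕ} {P : Set (EuclideanSpace ℝ (Fin n))}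
    (hP : IsZonotope P) : DecomposesFaceToFace P IsParallelotope := by
  classical
  obtain ⟨c, k, a, rfl⟩ := hP
  obtain ⟨h, hind⟩ := exists_generic_heights a
  let B : Set (StrongDual ℝ (EuclideanSpace ℝ (Fin n))) :=
    {w | Submodule.span ℝ (a '' {i | w (a i) = h i}) = Submodule.span ℝ (Set.range a)}
  have hspan : ∀ w ∈ B, affineSpan ℝ (c +ᵥ liftTile a h w) =
      affineSpan ℝ (c +ᵥ parallelepiped a) := by
    intro w hw
    have hsub : affineSpan ℝ (c +ᵥ liftTile a h w) ≤ affineSpan ℝ (c +ᵥ parallelepiped a) :=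
      affineSpan_mono ℝ (Set.vadd_set_mono liftTile_subset_parallelepiped)
    obtain ⟨b, hb⟩ := liftTile_eq_vadd a h w
    have hdir : (affineSpan ℝ (c +ᵥ liftTile a h w)).direction =
        (affineSpan ℝ (c +ᵥ parallelepiped a)).direction := by
      rw [hb, vadd_vadd, affineSpan_vadd_parallelepiped, affineSpan_vadd_parallelepiped,
        AffineSubspace.direction_mk', AffineSubspace.direction_mk', ← (show _ = _ from hw)]
      congr 1
      ext x
      simp
    refine AffineSubspace.eq_of_direction_eq_of_nonempty_of_le hdir ?_ hsub
    rw [hb, vadd_vadd, affineSpan_vadd_parallelepiped]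
    exact AffineSubspace.mk'_nonempty _ _
  have hface : ∀ w w', IsExposed ℝ (c +ᵥ liftTile a h w)
      ((c +ᵥ liftTile a h w) ∩ (c +ᵥ liftTile a h w')) := by
    intro w w'
    rw [← Set.vadd_set_inter]
    refine isExposed_vadd c fun hne => ⟨w' - w, liftTile_inter_eq hne⟩
  refine ⟨(fun w => c +ᵥ liftTile a h w) '' B, ⟨?_, ?_, ?_, ?_⟩, ?_, ?_⟩
  -- A tile depends only on the sign pattern of `w (a i) - h i`, which leaves finitely many.
  · let g : Set (Fin k) × Set (Fin k) → Set (EuclideanSpace ℝ (Fin n)) := fun S =>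
      c +ᵥ ((fun t : Fin k → ℝ => ∑ i, t i • a i) ''
        {t | ∀ i, 0 ≤ t i ∧ t i ≤ 1 ∧ (i ∈ S.1 → t i = 1) ∧ (i ∈ S.2 → t i = 0)})
    refine (Set.finite_range g).subset ?_
    rintro _ ⟨w, -, rfl⟩
    exact ⟨({i | h i < w (a i)}, {i | w (a i) < h i}), rfl⟩
  · ext x
    constructor
    · rintro ⟨_, ⟨w, -, rfl⟩, hx⟩
      exact Set.vadd_set_mono liftTile_subset_parallelepiped hx
    · rintro ⟨x, hx, rfl⟩
      obtain ⟨w, hw, hxw⟩ := exists_mem_liftTile h hx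
      exact ⟨_, ⟨w, hw, rfl⟩, x, hxw, rfl⟩
  · rintro _ ⟨w, hw, rfl⟩
    exact hspan w hw
  · rintro _ ⟨w, hw, rfl⟩ _ ⟨w', hw', rfl⟩ hne
    rw [Set.disjoint_left]
    rintro x hx hx'
    apply hne
    obtain ⟨y, ⟨hy, hy'⟩, rfl⟩ : x ∈ c +ᵥ (liftTile a h w ∩ liftTile a h w') := by
      rw [Set.vadd_set_inter]
      exact ⟨intrinsicInterior_subset hx, intrinsicInterior_subset hx'⟩
    have hmax : y ∈ (w' - w).toExposed (liftTile a h w) :=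
      liftTile_inter_eq ⟨y, hy, hy'⟩ ▸ ⟨hy, hy'⟩
    have hconst := eq_of_mem_intrinsicInterior_of_forall_le hx (w' - w) (by
      rintro _ ⟨z, hz, rfl⟩
      have := hmax.2 z hz
      simp only [sub_apply, vadd_eq_add, map_add] at this ⊢
      linarith)
    -- A shared relative interior point makes `w' - w` constant on a tile of full dimension, hence
    -- zero on all generators; the two tiles then coincide.
    have hvan : ∀ i, (w' - w) (a i) = 0 := by
      intro i
      have hle : affineSpan ℝ (c +ᵥ parallelepiped a) ≤
          (AffineSubspace.mk' (c +ᵥ y)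
            (LinearMap.ker ((w' - w : StrongDual ℝ (EuclideanSpace ℝ (Fin n))) :
              EuclideanSpace ℝ (Fin n) →ₗ[ℝ] ℝ))) := by
        rw [← hspan w hw]
        refine affineSpan_le.2 fun z hz => ?_
        have := hconst z hz
        rw [SetLike.mem_coe, AffineSubspace.mem_mk', LinearMap.mem_ker]
        rw [vsub_eq_sub, map_sub, sub_eq_zero]
        exact this
      have hdir := AffineSubspace.direction_le hle
      rw [AffineSubspace.direction_mk', affineSpan_vadd_parallelepiped,
        AffineSubspace.direction_mk'] at hdir
      exact hdir (Submodule.subset_span ⟨i, rfl⟩)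
    have hww : ∀ i, w' (a i) = w (a i) := fun i => sub_eq_zero.1 (hvan i)
    dsimp only
    rw [liftTile, liftTile]
    simp only [IsCompatible, hww]
  · rintro _ ⟨w, -, rfl⟩ _ ⟨w', -, rfl⟩
    refine ⟨hface w w', ?_⟩
    rw [Set.inter_comm]
    exact hface w' w
  · rintro _ ⟨w, -, rfl⟩
    obtain ⟨b, hb⟩ := liftTile_eq_vadd a h w
    dsimp only
    rw [hb, vadd_vadd]
    exact isParallelotope_vadd_parallelepiped _ (hind w)

end Zonotope

/-! ### Connectivity of chambers of a hyperplane arrangement -/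

section Chambers

theorem mul_pos_trans {x y z : ℝ} (h1 : 0 < x * y) (h2 : 0 < y * z) : 0 < x * z := by
  rcases pos_and_pos_or_neg_and_neg_of_mul_pos h1 with ⟨hx, hy⟩ | ⟨hx, hy⟩
  · exact mul_pos hx ((mul_pos_iff_of_pos_left hy).1 h2)
  · rcases pos_and_pos_or_neg_and_neg_of_mul_pos h2 with ⟨hy', _⟩ | ⟨_, hz⟩
    · exact absurd hy hy'.not_gt
    · exact mul_pos_of_neg_of_neg hx hz

theorem eventually_mul_add_mul_pos {x y : ℝ} (hx : x ≠ 0) :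
    ∀ᶠ ε in nhdsWithin (0 : ℝ) (Set.Ioi 0), 0 < x * (x + ε * y) := by
  have hc : Continuous fun ε : ℝ => x * (x + ε * y) := by fun_prop
  have : 0 < x * (x + 0 * y) := by simpa using mul_self_pos.2 hx
  exact ((hc.tendsto 0).eventually_const_lt this).filter_mono nhdsWithin_le_nhds

theorem eventually_add_mul_ne_zero (x : ℝ) {y : ℝ} (hy : y ≠ 0) :
    ∀ᶠ ε in nhdsWithin (0 : ℝ) (Set.Ioi 0), x + ε * y ≠ 0 := by
  by_cases hx : x = 0
  · filter_upwards [self_mem_nhdsWithin] with ε hε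
    rw [hx, zero_add]
    exact mul_ne_zero (ne_of_gt hε) hy
  · filter_upwards [eventually_mul_add_mul_pos (y := y) hx] with ε hε h0
    rw [h0, mul_zero] at hε
    exact lt_irrefl _ hε

variable {W X : Type*} [AddCommGroup W] [Module ℝ W]

/-- A generic point can be moved within its chamber so that the segment from a given generic point
never crosses two distinct hyperplanes simultaneously. -/
theorem exists_generic_in_chamber {A : Set (Module.Dual ℝ W)} (hA : A.Finite) {u v : W}
    (hu : ∀ a ∈ A, a u ≠ 0) (hv : ∀ a ∈ A, a v ≠ 0) :
    ∃ v', (∀ a ∈ A, 0 < a v * a v') ∧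
      ∀ a ∈ A, ∀ b ∈ A, a u * b v' = b u * a v' → ∃ c : ℝ, b = c • a := by
  have : Finite A := hA
  let ι := {p : A × A // ¬ ∃ c : ℝ, p.2.1 = c • p.1.1}
  -- For non-proportional `a` and `b`, meeting both hyperplanes at the same parameter is one
  -- nontrivial linear condition on the endpoint; `z` is a direction that leaves all these
  -- conditions at once.
  obtain ⟨z, hz⟩ := Module.Dual.exists_forall_ne_zero_of_forall_exists (K := ℝ) (M := W)
    (fun p : ι => p.1.1.1 u • p.1.2.1 - p.1.2.1 u • p.1.1.1) (by
      rintro ⟨⟨⟨a, ha⟩, ⟨b, hb⟩⟩, hab⟩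
      by_contra! h0
      refine hab ⟨b u / a u, LinearMap.ext fun x => ?_⟩
      have := h0 x
      simp only [LinearMap.sub_apply, LinearMap.smul_apply, smul_eq_mul] at this ⊢
      field_simp [hu a ha]
      linarith)
  have h1 : ∀ᶠ ε in nhdsWithin (0 : ℝ) (Set.Ioi 0), ∀ a ∈ A, 0 < a v * (a v + ε * a z) :=
    (Filter.eventually_all_finite hA).2 fun a ha => eventually_mul_add_mul_pos (hv a ha)
  have h2 : ∀ᶠ ε in nhdsWithin (0 : ℝ) (Set.Ioi 0), ∀ p : ι,
      (p.1.1.1 u * p.1.2.1 v - p.1.2.1 u * p.1.1.1 v) +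
        ε * (p.1.1.1 u * p.1.2.1 z - p.1.2.1 u * p.1.1.1 z) ≠ 0 :=
    Filter.eventually_all.2 fun p => eventually_add_mul_ne_zero _ (by simpa using hz p)
  obtain ⟨ε, hε1, hε2⟩ := (h1.and h2).exists
  refine ⟨v + ε • z, fun a ha => by simpa using hε1 a ha, fun a ha b hb hab => ?_⟩
  by_contra hc
  apply hε2 ⟨(⟨a, ha⟩, ⟨b, hb⟩), hc⟩
  simp only [map_add, map_smul, smul_eq_mul] at hab
  simp only
  linarith

/-- A function on the complement of finitely many linear hyperplanes is constant if it takes the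
same value at points that are separated by at most one hyperplane. -/
theorem eq_of_forall_adjacent_eq {A : Set (Module.Dual ℝ W)} (hA : A.Finite) (f : W → X)
    (hadj : ∀ u v w, (∀ a ∈ A, a u ≠ 0) → (∀ a ∈ A, a v ≠ 0) →
      (∀ a ∈ A, a w ≠ 0 → 0 < a w * a u ∧ 0 < a w * a v) →
      (∀ a ∈ A, ∀ b ∈ A, a w = 0 → b w = 0 → ∃ c : ℝ, b = c • a) → f u = f v)
    {u v : W} (hu : ∀ a ∈ A, a u ≠ 0) (hv : ∀ a ∈ A, a v ≠ 0) : f u = f v := by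
  classical
  induction hN : {a ∈ A | a u * a v < 0}.ncard using Nat.strong_induction_on generalizing u with
  | _ N ih =>
    have hfin : ∀ x y : W, {a ∈ A | a x * a y < 0}.Finite := fun x y => hA.subset fun a ha => ha.1
    rcases Set.eq_empty_or_nonempty {a ∈ A | a u * a v < 0} with he | hne
    · refine hadj u v u hu hv (fun a ha _ => ⟨mul_self_pos.2 (hu a ha), ?_⟩)
        (fun a ha _ _ h0 => absurd h0 (hu a ha))
      refine lt_of_le_of_ne (not_lt.1 fun hlt => ?_) (mul_ne_zero (hu a ha) (hv a ha)).symm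
      exact (Set.eq_empty_iff_forall_notMem.1 he a) ⟨ha, hlt⟩
    -- Induction on the number of functionals separating the two points: `v'` replaces `v` only as a
    -- target, `w` is the first crossing on the way to it, and `u₁` lies just behind that crossing.
    obtain ⟨v', hvv, hdet⟩ := exists_generic_in_chamber hA hu hv
    have hv' : ∀ a ∈ A, a v' ≠ 0 := fun a ha h0 => by
      have := hvv a ha
      rw [h0, mul_zero] at this
      exact lt_irrefl _ this
    have hsep : ∀ a ∈ A, (a u * a v < 0 ↔ a u * a v' < 0) := by
      intro a ha
      constructor <;> intro h
      · have := mul_pos_trans (x := -a u) (y := a v) (z := a v') (by linarith) (hvv a ha)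
        linarith
      · have := mul_pos_trans (x := -a u) (y := a v') (z := a v) (by linarith)
          (by linarith [hvv a ha])
        linarith
    obtain ⟨a₀, ⟨ha₀, hs₀⟩, hmin⟩ := Set.exists_min_image _ (fun a => a u / (a u - a v'))
      (hfin u v) hne
    set t := a₀ u / (a₀ u - a₀ v') with ht
    have hdiff : ∀ a ∈ A, a u * a v' < 0 → 0 < a u * (a u - a v') := by
      intro a ha h
      nlinarith [mul_self_nonneg (a u)]
    have hs₀' := (hsep a₀ ha₀).1 hs₀
    have hd₀ : a₀ u - a₀ v' ≠ 0 := fun h0 => by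
      have := hdiff a₀ ha₀ hs₀'
      rw [h0, mul_zero] at this
      exact lt_irrefl _ this
    have htm : t * (a₀ u - a₀ v') = a₀ u := div_mul_cancel₀ _ hd₀
    have ht0 : 0 < t := by
      have h1 := hdiff a₀ ha₀ hs₀'
      have h2 : 0 < t * ((a₀ u - a₀ v') * (a₀ u - a₀ v')) := by
        rw [← mul_assoc, htm]; exact h1
      exact pos_of_mul_pos_left h2 (mul_self_nonneg _)
    have ht1 : t < 1 := by
      by_contra! h1
      have h2 : (1 - t) * (a₀ u * (a₀ u - a₀ v')) = - (a₀ u * a₀ v') := by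
        linear_combination (-(a₀ u)) * htm
      have h3 := hdiff a₀ ha₀ hs₀'
      nlinarith
    set w := u + t • (v' - u) with hw
    have hwa : ∀ a : Module.Dual ℝ W, a w = a u - t * (a u - a v') := by
      intro a; simp only [hw, map_add, map_smul, map_sub, smul_eq_mul]; ring
    have hw₀ : a₀ w = 0 := by rw [hwa, htm, sub_self]
    have hnn : ∀ a ∈ A, 0 ≤ a w * a u := by
      intro a ha
      rw [hwa]
      by_cases hs : a u * a v' < 0
      · have h1 := hdiff a ha hs
        have h2 : t ≤ a u / (a u - a v') := hmin a ⟨ha, (hsep a ha).2 hs⟩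
        have hd : a u - a v' ≠ 0 := fun h0 => by
          rw [h0, mul_zero] at h1; exact lt_irrefl _ h1
        have h3 : a u / (a u - a v') * (a u - a v') = a u := div_mul_cancel₀ _ hd
        have h4 : (a u - t * (a u - a v')) * a u =
            (a u / (a u - a v') - t) * (a u * (a u - a v')) := by
          linear_combination (-(a u)) * h3
        rw [h4]
        exact mul_nonneg (by linarith) h1.le
      · nlinarith [mul_self_nonneg (a u)]
    have hpos : ∀ a ∈ A, a w ≠ 0 → 0 < a w * a u := fun a ha h0 =>
      lt_of_le_of_ne (hnn a ha) (mul_ne_zero h0 (hu a ha)).symm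
    have hopp : ∀ a ∈ A, a w = 0 → 0 < (a v' - a u) * a v' := by
      intro a ha h0
      rw [hwa] at h0
      have h1 : 0 < a v' * a v' := mul_self_pos.2 (hv' a ha)
      have h2 : (1 - t) * ((a v' - a u) * a v') = a v' * a v' := by
        linear_combination (-(a v')) * h0
      have h3 : 0 < (1 - t) * ((a v' - a u) * a v') := h2 ▸ h1
      exact (mul_pos_iff_of_pos_left (by linarith)).1 h3
    have hev : ∀ᶠ ε in nhdsWithin (0 : ℝ) (Set.Ioi 0), ∀ a ∈ A, a w ≠ 0 →
        0 < a w * (a w + ε * (a v' - a u)) := by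
      refine (Filter.eventually_all_finite hA).2 fun a ha => ?_
      by_cases h0 : a w = 0
      · exact Filter.Eventually.of_forall fun _ h => absurd h0 h
      · filter_upwards [eventually_mul_add_mul_pos (y := a v' - a u) h0] with ε hε _ using hε
    obtain ⟨ε, hε, hε0⟩ := (hev.and self_mem_nhdsWithin).exists
    have hε0 : 0 < ε := hε0
    set u₁ := w + ε • (v' - u) with hu₁
    have hua : ∀ a : Module.Dual ℝ W, a u₁ = a w + ε * (a v' - a u) := by
      intro a; simp only [hu₁, map_add, map_smul, map_sub, smul_eq_mul]
    have hcross : ∀ a ∈ A, a w = 0 → 0 < a u₁ * a v' := by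
      intro a ha h0
      rw [hua, h0, zero_add, mul_assoc]
      exact mul_pos hε0 (hopp a ha h0)
    have hstay : ∀ a ∈ A, a w ≠ 0 → 0 < a w * a u₁ := by
      intro a ha h0
      rw [hua]
      exact hε a ha h0
    have hg₁ : ∀ a ∈ A, a u₁ ≠ 0 := by
      intro a ha h1
      by_cases h0 : a w = 0
      · have := hcross a ha h0
        rw [h1, zero_mul] at this
        exact lt_irrefl _ this
      · have := hstay a ha h0
        rw [h1, mul_zero] at this
        exact lt_irrefl _ this
    have hfu : f u = f u₁ := by
      refine hadj u u₁ w hu hg₁ (fun a ha h0 => ⟨hpos a ha h0, hstay a ha h0⟩) ?_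
      intro a ha b hb ha0 hb0
      refine hdet a ha b hb ?_
      rw [hwa] at ha0 hb0
      have : t * (a u * b v' - b u * a v') = 0 := by
        linear_combination a u * hb0 - b u * ha0
      rcases mul_eq_zero.1 this with h | h
      · exact absurd h ht0.ne'
      · linarith
    rw [hfu]
    refine ih _ ?_ hg₁ rfl
    rw [← hN]
    refine Set.ncard_lt_ncard ?_ (hfin u v)
    have hnot : ∀ a ∈ A, a w = 0 → 0 < a u₁ * a v := fun a ha h0 =>
      mul_pos_trans (hcross a ha h0) (by linarith [hvv a ha])
    rw [Set.ssubset_iff_of_subset]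
    · exact ⟨a₀, ⟨ha₀, hs₀⟩, fun h => (hnot a₀ ha₀ hw₀).not_gt h.2⟩
    · rintro a ⟨ha, hlt⟩
      refine ⟨ha, ?_⟩
      by_cases h0 : a w = 0
      · exact absurd hlt (hnot a ha h0).not_gt
      · have h1 := mul_pos_trans (x := a u) (by linarith [hpos a ha h0]) (hstay a ha h0)
        have h2 := mul_pos_trans (x := a u) (z := -a v) h1 (by linarith)
        linarith

end Chambers

/-! ### Slice lengths of planar convex bodies -/

section Planar

open MeasureTheory Filter Topology

/-- The length of the vertical slice of a planar set over `r`. -/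
noncomputable def fiberLength (K : Set (ℝ × ℝ)) (r : ℝ) : ℝ := volume.real {t : ℝ | (r, t) ∈ K}

theorem isCompact_fiber {K : Set (ℝ × ℝ)} (hK : IsCompact K) (r : ℝ) :
    IsCompact {t : ℝ | (r, t) ∈ K} := by
  have hcl : IsClosed {t : ℝ | (r, t) ∈ K} :=
    hK.isClosed.preimage (by fun_prop : Continuous fun t : ℝ => (r, t))
  exact (hK.image continuous_snd).of_isClosed_subset hcl fun t ht => ⟨(r, t), ht, rfl⟩

theorem convex_fiber {K : Set (ℝ × ℝ)} (hK : Convex ℝ K) (r : ℝ) :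
    Convex ℝ {t : ℝ | (r, t) ∈ K} := by
  intro s hs t ht a b ha hb hab
  have := hK hs ht ha hb hab
  simp only [Prod.smul_mk, Prod.mk_add_mk, smul_eq_mul, ← add_mul, hab, one_mul] at this
  exact this

theorem fiber_eq_Icc {K : Set (ℝ × ℝ)} (hK : IsCompact K) (hc : Convex ℝ K) {r : ℝ}
    (hr : r ∈ Prod.fst '' K) : ∃ a b, a ≤ b ∧ {t : ℝ | (r, t) ∈ K} = Set.Icc a b := by
  have hne : {t : ℝ | (r, t) ∈ K}.Nonempty := by
    obtain ⟨⟨_, t⟩, ht, rfl⟩ := hr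
    exact ⟨t, ht⟩
  have h := eq_Icc_of_connected_compact ⟨hne, (convex_fiber hc r).isPreconnected⟩
    (isCompact_fiber hK r)
  refine ⟨_, _, ?_, h⟩
  rw [h] at hne
  exact Set.nonempty_Icc.1 hne

/-- By convexity the intermediate slice contains the convex combination of the two slices; the
contribution of the slice over `q` is dropped. This gives lower semicontinuity at `r` along the
segment. -/
theorem mul_fiberLength_le {K : Set (ℝ × ℝ)} (hK : IsCompact K) (hc : Convex ℝ K) {r q l : ℝ}
    (hr : r ∈ Prod.fst '' K) (hq : q ∈ Prod.fst '' K) (h0 : 0 ≤ l) (h1 : l ≤ 1) :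
    (1 - l) * fiberLength K r ≤ fiberLength K ((1 - l) * r + l * q) := by
  obtain ⟨a, b, hab, hF⟩ := fiber_eq_Icc hK hc hr
  obtain ⟨c, d, hcd, hG⟩ := fiber_eq_Icc hK hc hq
  have hmem : ∀ x ∈ Set.Icc a b, ∀ y ∈ Set.Icc c d,
      (1 - l) * x + l * y ∈ {t : ℝ | ((1 - l) * r + l * q, t) ∈ K} := by
    intro x hx y hy
    rw [← hF] at hx
    rw [← hG] at hy
    simpa using hc hx hy (sub_nonneg.2 h1) h0 (sub_add_cancel 1 l)
  have hsub : Set.Icc ((1 - l) * a + l * c) ((1 - l) * b + l * d) ⊆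
      {t : ℝ | ((1 - l) * r + l * q, t) ∈ K} := by
    rw [← segment_eq_Icc (by nlinarith)]
    exact (convex_fiber hc _).segment_subset
      (hmem a ⟨le_rfl, hab⟩ c ⟨le_rfl, hcd⟩) (hmem b ⟨hab, le_rfl⟩ d ⟨hcd, le_rfl⟩)
  have hle := measureReal_mono (μ := volume) hsub (isCompact_fiber hK _).measure_ne_top
  rw [Real.volume_real_Icc_of_le (by nlinarith)] at hle
  rw [fiberLength, fiberLength, hF, Real.volume_real_Icc_of_le hab]
  nlinarith

/-- Upper semicontinuity by compactness: nearby slices stay inside a small thickening of the slice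
over `r`. -/
theorem eventually_fiberLength_lt {K : Set (ℝ × ℝ)} (hK : IsCompact K) (r : ℝ) {c : ℝ}
    (hc : fiberLength K r < c) : ∀ᶠ x in 𝓝 r, fiberLength K x < c := by
  have hF := isCompact_fiber hK r
  have hth := tendsto_measure_cthickening_of_isCompact (μ := volume) hF
  have hlt : volume {t : ℝ | (r, t) ∈ K} < ENNReal.ofReal c := by
    rw [← ENNReal.ofReal_toReal hF.measure_ne_top]
    exact (ENNReal.ofReal_lt_ofReal_iff_of_nonneg ENNReal.toReal_nonneg).2 hc
  have hev := (hth.eventually_lt_const hlt).filter_mono (nhdsWithin_le_nhds (s := Set.Ioi 0))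
  obtain ⟨δ, hδ, hδ0⟩ := (hev.and self_mem_nhdsWithin).exists
  have hδ0 : 0 < δ := hδ0
  have hbad : IsClosed (Prod.fst ''
      (K ∩ {z | z.2 ∉ Metric.thickening δ {t : ℝ | (r, t) ∈ K}})) := by
    refine ((hK.inter_right ?_).image continuous_fst).isClosed
    exact (Metric.isOpen_thickening.preimage continuous_snd).isClosed_compl
  have hr : r ∉ Prod.fst '' (K ∩ {z | z.2 ∉ Metric.thickening δ {t : ℝ | (r, t) ∈ K}}) := by
    rintro ⟨⟨_, t⟩, ⟨h1, h2⟩, rfl⟩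
    exact h2 (Metric.self_subset_thickening hδ0 _ h1)
  filter_upwards [hbad.isOpen_compl.mem_nhds hr] with x hx
  have hsub : {t : ℝ | (x, t) ∈ K} ⊆ Metric.cthickening δ {t : ℝ | (r, t) ∈ K} := by
    intro t ht
    refine Metric.thickening_subset_cthickening _ _ ?_
    by_contra h
    exact hx ⟨(x, t), ⟨ht, h⟩, rfl⟩
  have h1 : volume {t : ℝ | (x, t) ∈ K} < ENNReal.ofReal c := (measure_mono hsub).trans_lt hδ
  exact ENNReal.toReal_lt_of_lt_ofReal h1

theorem tendsto_fiberLength {K : Set (ℝ × ℝ)} (hK : IsCompact K) (hc : Convex ℝ K) {r q : ℝ}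
    (hr : r ∈ Prod.fst '' K) (hq : q ∈ Prod.fst '' K) (hrq : r ≠ q) :
    Tendsto (fiberLength K) (𝓝[segment ℝ r q] r) (𝓝 (fiberLength K r)) := by
  have hlow : Tendsto (fun x => (1 - (x - r) / (q - r)) * fiberLength K r)
      (𝓝[segment ℝ r q] r) (𝓝 (fiberLength K r)) := by
    have : Continuous fun x => (1 - (x - r) / (q - r)) * fiberLength K r := by fun_prop
    simpa using (this.tendsto r).mono_left nhdsWithin_le_nhds
  have hqr : q - r ≠ 0 := sub_ne_zero.2 hrq.symm
  refine tendsto_order.2 ⟨fun c hcl => ?_, fun c hcl =>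
    (eventually_fiberLength_lt hK r hcl).filter_mono nhdsWithin_le_nhds⟩
  filter_upwards [hlow.eventually_const_lt hcl, self_mem_nhdsWithin] with x hx hxs
  refine hx.trans_le ?_
  obtain ⟨l, ⟨h0, h1⟩, rfl⟩ := (segment_eq_image ℝ r q ▸ hxs : x ∈ _ '' _)
  have hl : ((1 - l) • r + l • q - r) / (q - r) = l := by
    simp only [smul_eq_mul]; field_simp; ring
  dsimp only
  rw [hl]
  exact mul_fiberLength_le hK hc hr hq h0 h1

theorem tendsto_fiberLength_zero {K : Set (ℝ × ℝ)} {l : Filter ℝ}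
    (h : ∀ᶠ x in l, x ∉ Prod.fst '' K) : Tendsto (fiberLength K) l (𝓝 0) := by
  refine tendsto_const_nhds.congr' ?_
  filter_upwards [h] with x hx
  have : {t : ℝ | (x, t) ∈ K} = ∅ :=
    Set.eq_empty_of_forall_notMem fun t ht => hx ⟨(x, t), ht, rfl⟩
  simp [fiberLength, this]

theorem tendsto_fiberLength_right {K : Set (ℝ × ℝ)} (hK : IsCompact K) (hc : Convex ℝ K)
    {p q : ℝ} (hI : Prod.fst '' K = Set.Icc p q) (r : ℝ) :
    Tendsto (fiberLength K) (𝓝[>] r) (𝓝 (if p ≤ r ∧ r < q then fiberLength K r else 0)) := by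
  split_ifs with h
  · refine (tendsto_fiberLength hK hc (hI ▸ ⟨h.1, h.2.le⟩) (hI ▸ ⟨h.1.trans h.2.le, le_rfl⟩)
      h.2.ne).mono_left ?_
    rw [segment_eq_Icc h.2.le]
    exact nhdsWithin_le_of_mem (Icc_mem_nhdsGT h.2)
  · apply tendsto_fiberLength_zero
    rw [hI]
    rcases lt_or_ge r p with hp | hp
    · filter_upwards [nhdsWithin_le_nhds (Iio_mem_nhds hp)] with x hx h2
      exact h2.1.not_gt hx
    · have hq : q ≤ r := not_lt.1 fun h2 => h ⟨hp, h2⟩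
      filter_upwards [self_mem_nhdsWithin] with x hx h2
      exact (h2.2.trans hq).not_gt hx

theorem tendsto_fiberLength_left {K : Set (ℝ × ℝ)} (hK : IsCompact K) (hc : Convex ℝ K)
    {p q : ℝ} (hI : Prod.fst '' K = Set.Icc p q) (r : ℝ) :
    Tendsto (fiberLength K) (𝓝[<] r) (𝓝 (if p < r ∧ r ≤ q then fiberLength K r else 0)) := by
  split_ifs with h
  · refine (tendsto_fiberLength hK hc (hI ▸ ⟨h.1.le, h.2⟩) (hI ▸ ⟨le_rfl, h.1.le.trans h.2⟩)
      h.1.ne').mono_left ?_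
    rw [segment_symm, segment_eq_Icc h.1.le]
    exact nhdsWithin_le_of_mem (Icc_mem_nhdsLT h.1)
  · apply tendsto_fiberLength_zero
    rw [hI]
    rcases lt_or_ge q r with hp | hp
    · filter_upwards [nhdsWithin_le_nhds (Ioi_mem_nhds hp)] with x hx h2
      exact h2.2.not_gt hx
    · have hq : r ≤ p := not_lt.1 fun h2 => h ⟨h2, hp⟩
      filter_upwards [self_mem_nhdsWithin] with x hx h2
      exact (hq.trans h2.1).not_gt hx

theorem exists_fst_image_eq_Icc {K : Set (ℝ × ℝ)} (hK : IsCompact K) (hc : Convex ℝ K)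
    (hne : K.Nonempty) : ∃ p q, p ≤ q ∧ Prod.fst '' K = Set.Icc p q := by
  have h := eq_Icc_of_connected_compact
    ⟨hne.image Prod.fst, hc.isPreconnected.image _ continuous_fst.continuousOn⟩
    (hK.image continuous_fst)
  refine ⟨_, _, ?_, h⟩
  have := hne.image Prod.fst
  rw [h] at this
  exact Set.nonempty_Icc.1 this

/-- The point reflection exchanges the two extreme slices. -/
theorem fiberLength_eq_of_symmetric {K : Set (ℝ × ℝ)} {c : ℝ × ℝ} (hc : ∀ z ∈ K, c - z ∈ K)
    {p q : ℝ} (hpq : p ≤ q) (hI : Prod.fst '' K = Set.Icc p q) :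
    fiberLength K p = fiberLength K q := by
  have hmem : ∀ x ∈ Set.Icc p q, c.1 - x ∈ Set.Icc p q := by
    intro x hx
    rw [← hI] at hx ⊢
    obtain ⟨z, hz, rfl⟩ := hx
    exact ⟨c - z, hc z hz, rfl⟩
  have hcq : c.1 - p = q := by
    have h1 := (hmem p ⟨le_rfl, hpq⟩).2
    have h2 := (hmem q ⟨hpq, le_rfl⟩).1
    linarith
  have hset : {t : ℝ | (p, t) ∈ K} = (fun t => c.2 - t) ⁻¹' {t : ℝ | (q, t) ∈ K} := by
    ext t
    constructor
    · intro ht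
      have := hc _ ht
      rwa [show c - (p, t) = (q, c.2 - t) by ext <;> simp [← hcq]] at this
    · intro ht
      have := hc _ ht
      rwa [show c - (q, c.2 - t) = (p, t) by ext <;> simp [← hcq]] at this
  rw [fiberLength, fiberLength, hset, measureReal_def, measureReal_def]
  congr 1
  exact (Measure.measurePreserving_sub_left volume c.2).measure_preimage_emb
    (Homeomorph.subLeft c.2).measurableEmbedding _

theorem fiberLength_iUnion {ι : Type*} [Fintype ι] {K : ι → Set (ℝ × ℝ)}
    (hK : ∀ i, IsCompact (K i)) {r : ℝ}
    (hd : ∀ i j, i ≠ j → {t : ℝ | (r, t) ∈ K i ∩ K j}.Subsingleton) :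
    fiberLength (⋃ i, K i) r = ∑ i, fiberLength (K i) r := by
  have hU : {t : ℝ | (r, t) ∈ ⋃ i, K i} = ⋃ i, {t : ℝ | (r, t) ∈ K i} := by
    ext t; simp
  rw [fiberLength, hU, measureReal_def, measure_iUnion₀, tsum_fintype, ENNReal.toReal_sum]
  · rfl
  · exact fun i _ => (isCompact_fiber (hK i) r).measure_ne_top
  · exact fun i j hij => (hd i j hij).measure_zero volume
  · exact fun i => (isCompact_fiber (hK i) r).measurableSet.nullMeasurableSet

/-- If a planar convex body is tiled by centrally symmetric convex bodies, then its leftmost and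
its rightmost vertical slice have the same length. -/
theorem fiberLength_eq_of_tiling {ι : Type*} [Fintype ι] {K : Set (ℝ × ℝ)}
    {T : ι → Set (ℝ × ℝ)} (hK : IsCompact K) (hKc : Convex ℝ K) (hT : ∀ i, IsCompact (T i))
    (hTc : ∀ i, Convex ℝ (T i)) (hTne : ∀ i, (T i).Nonempty)
    (hTs : ∀ i, ∃ c, ∀ z ∈ T i, c - z ∈ T i) (hU : K = ⋃ i, T i) {B : Set ℝ} (hB : B.Finite)
    (hd : ∀ r ∉ B, ∀ i j, i ≠ j → {t : ℝ | (r, t) ∈ T i ∩ T j}.Subsingleton)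
    {p q : ℝ} (hpq : p ≤ q) (hI : Prod.fst '' K = Set.Icc p q) :
    fiberLength K p = fiberLength K q := by
  classical
  choose P Q hPQ hTI using fun i => exists_fst_image_eq_Icc (hT i) (hTc i) (hTne i)
  have hTeq : ∀ i, fiberLength (T i) (P i) = fiberLength (T i) (Q i) := fun i => by
    obtain ⟨c, hc⟩ := hTs i
    exact fiberLength_eq_of_symmetric hc (hPQ i) (hTI i)
  have hsum : ∀ r ∉ B, fiberLength K r = ∑ i, fiberLength (T i) r := fun r hr => by
    rw [hU]; exact fiberLength_iUnion hT (hd r hr)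
  -- Right limit minus left limit: interior positions contribute nothing, so only the two ends
  -- remain, with opposite signs.
  have hjump : ∀ (L : Set (ℝ × ℝ)) (a b r : ℝ), a ≤ b →
      (if a ≤ r ∧ r < b then fiberLength L r else 0) -
        (if a < r ∧ r ≤ b then fiberLength L r else 0) =
      (if r = a then fiberLength L a else 0) - if r = b then fiberLength L b else 0 := by
    intro L a b r hab
    rcases lt_trichotomy r a with h1 | rfl | h1
    · simp [h1.ne, h1.not_ge, h1.not_gt, (h1.trans_le hab).ne]
    · rcases hab.eq_or_lt with rfl | hab
      · simp
      · simp [hab, hab.ne]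
    · rcases lt_trichotomy r b with h2 | rfl | h2
      · simp [h1, h2, h1.ne', h2.ne, h1.le, h2.le]
      · simp [h1, h1.ne']
      · simp [h1.ne', h2.ne', h2.not_ge, h2.not_gt]
  have hloc : ∀ r : ℝ,
      ((if r = p then fiberLength K p else 0) - if r = q then fiberLength K q else 0) =
      ∑ i, ((if r = P i then fiberLength (T i) (P i) else 0) -
        if r = Q i then fiberLength (T i) (Q i) else 0) := by
    intro r
    have hBr : ∀ᶠ x in 𝓝[≠] r, x ∉ B := by
      have h1 : IsClosed (B \ {r}) := (hB.subset Set.sdiff_subset).isClosed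
      have h2 : ∀ᶠ x in 𝓝 r, x ∉ B \ {r} := h1.isOpen_compl.mem_nhds (by simp)
      filter_upwards [h2.filter_mono nhdsWithin_le_nhds, self_mem_nhdsWithin] with x hx hxr hxB
      exact hx ⟨hxB, hxr⟩
    have hR := tendsto_nhds_unique
      ((tendsto_fiberLength_right hK hKc hI r).congr' (by
        filter_upwards [hBr.filter_mono (nhdsWithin_mono r fun x hx => ne_of_gt hx)] with x hx
        exact hsum x hx))
      (tendsto_finsetSum Finset.univ fun i _ =>
        tendsto_fiberLength_right (hT i) (hTc i) (hTI i) r)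
    have hL := tendsto_nhds_unique
      ((tendsto_fiberLength_left hK hKc hI r).congr' (by
        filter_upwards [hBr.filter_mono (nhdsWithin_mono r fun x hx => ne_of_lt hx)] with x hx
        exact hsum x hx))
      (tendsto_finsetSum Finset.univ fun i _ =>
        tendsto_fiberLength_left (hT i) (hTc i) (hTI i) r)
    rw [← hjump K p q r hpq, hR, hL, ← Finset.sum_sub_distrib]
    exact Finset.sum_congr rfl fun i _ => hjump _ _ _ _ (hPQ i)
  -- Summing the jumps over all endpoints, the two jumps of each tile cancel, and so must those of
  -- `K`.
  let S : Finset ℝ := {p, q} ∪ (Finset.univ.image P ∪ Finset.univ.image Q)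
  have hS := Finset.sum_congr (rfl : S = S) fun r _ => hloc r
  rw [Finset.sum_comm] at hS
  have hPS : ∀ i, P i ∈ S := fun i => by simp [S]
  have hQS : ∀ i, Q i ∈ S := fun i => by simp [S]
  have hpS : p ∈ S := by simp [S]
  have hqS : q ∈ S := by simp [S]
  simp only [Finset.sum_sub_distrib, Finset.sum_ite_eq', hPS, hQS, hpS, hqS, if_true, hTeq,
    sub_self, Finset.sum_const_zero] at hS
  linarith

end Planar

/-! ### Faces of tiled polytopes -/

section Faces

variable {E : Type*} [NormedAddCommGroup E] [NormedSpace ℝ E]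

theorem parallelepiped_symmetric {ι : Type*} [Fintype ι] (a : ι → E) {x : E}
    (hx : x ∈ parallelepiped a) : ∑ i, a i - x ∈ parallelepiped a := by
  obtain ⟨t, ⟨h0, h1⟩, rfl⟩ := (mem_parallelepiped_iff _ _).1 hx
  refine (mem_parallelepiped_iff _ _).2 ⟨1 - t, ⟨sub_nonneg.2 h1, sub_le_self _ h0⟩, ?_⟩
  simp [sub_smul, Finset.sum_sub_distrib]

theorem liftTile_zero_zero {ι : Type*} [Fintype ι] (a : ι → E) :
    liftTile a 0 0 = parallelepiped a := by
  refine (liftTile_subset_parallelepiped).antisymm fun x hx => ?_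
  obtain ⟨t, ⟨h0, h1⟩, rfl⟩ := (mem_parallelepiped_iff _ _).1 hx
  exact ⟨t, fun i => ⟨h0 i, h1 i, fun h => absurd h (by simp), fun h => absurd h (by simp)⟩, rfl⟩

theorem liftTile_nonempty {ι : Type*} [Fintype ι] (a : ι → E) (h : ι → ℝ)
    (w : StrongDual ℝ E) : (liftTile a h w).Nonempty := by
  obtain ⟨c, hc⟩ := liftTile_eq_vadd a h w
  rw [hc]
  exact ⟨c +ᵥ (0 : E), 0, (mem_parallelepiped_iff _ _).2 ⟨0, ⟨le_rfl, zero_le_one⟩, by simp⟩, rfl⟩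

/-- With zero heights the zero functional selects the whole parallelepiped, so the face is its
intersection with the tile of `w`. -/
theorem toExposed_parallelepiped {ι : Type*} [Fintype ι] (a : ι → E) (w : StrongDual ℝ E) :
    w.toExposed (parallelepiped a) = liftTile a 0 w := by
  have hsub : liftTile a 0 w ⊆ liftTile a 0 0 := by
    rw [liftTile_zero_zero]; exact liftTile_subset_parallelepiped
  have h := liftTile_inter_eq (a := a) (h := 0) (w := 0) (w' := w)
    (by rw [Set.inter_eq_right.2 hsub]; exact liftTile_nonempty _ _ _)
  rw [Set.inter_eq_right.2 hsub, sub_zero, liftTile_zero_zero] at h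
  exact h.symm

theorem toExposed_vadd (w : StrongDual ℝ E) (c : E) (A : Set E) :
    w.toExposed (c +ᵥ A) = c +ᵥ w.toExposed A := by
  ext x
  constructor
  · rintro ⟨⟨x, hx, rfl⟩, hmax⟩
    refine ⟨x, ⟨hx, fun y hy => ?_⟩, rfl⟩
    simpa using hmax _ ⟨y, hy, rfl⟩
  · rintro ⟨x, ⟨hx, hmax⟩, rfl⟩
    refine ⟨⟨x, hx, rfl⟩, ?_⟩
    rintro _ ⟨y, hy, rfl⟩
    simpa using hmax y hy

/-- The faces of a zonotope are centrally symmetric. -/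
theorem toExposed_vadd_parallelepiped_symmetric {ι : Type*} [Fintype ι] (c : E) (a : ι → E)
    (w : StrongDual ℝ E) : ∃ s, ∀ x ∈ w.toExposed (c +ᵥ parallelepiped a),
      s - x ∈ w.toExposed (c +ᵥ parallelepiped a) := by
  obtain ⟨b, hb⟩ := liftTile_eq_vadd a 0 w
  rw [toExposed_vadd, toExposed_parallelepiped, hb, vadd_vadd]
  refine ⟨(2 : ℕ) • (c + b) + ∑ i : {i // w (a i) = (0 : ι → ℝ) i}, a i, ?_⟩
  rintro _ ⟨x, hx, rfl⟩
  refine ⟨_, parallelepiped_symmetric _ hx, ?_⟩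
  simp only [vadd_eq_add, two_nsmul]
  abel

/-- Finitely many affine functions, each of which is nonzero somewhere on a convex set, are
simultaneously nonzero at some point of it. -/
theorem Convex.exists_forall_ne {ι : Type*} [Finite ι] {C : Set E} (hC : Convex ℝ C)
    (hne : C.Nonempty) (f : ι → StrongDual ℝ E) (c : ι → ℝ) (h : ∀ i, ∃ y ∈ C, f i y ≠ c i) :
    ∃ y ∈ C, ∀ i, f i y ≠ c i := by
  classical
  have := Fintype.ofFinite ι
  suffices hs : ∀ s : Finset ι, ∃ y ∈ C, ∀ i ∈ s, f i y ≠ c i by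
    obtain ⟨y, hy, hy'⟩ := hs Finset.univ
    exact ⟨y, hy, fun i => hy' i (Finset.mem_univ i)⟩
  intro s
  induction s using Finset.induction_on with
  | empty =>
    obtain ⟨y, hy⟩ := hne
    exact ⟨y, hy, by simp⟩
  | insert i s _ ih =>
    obtain ⟨y, hy, hys⟩ := ih
    by_cases hyi : f i y = c i
    · obtain ⟨z, hz, hzi⟩ := h i
      have h1 : ∀ᶠ ε in nhdsWithin (0 : ℝ) (Set.Ioi 0), ∀ j ∈ s,
          0 < (f j y - c j) * (f j y - c j + ε * (f j z - f j y)) :=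
        (Filter.eventually_all_finset s).2 fun j hj =>
          eventually_mul_add_mul_pos (sub_ne_zero.2 (hys j hj))
      have h2 : ∀ᶠ ε in nhdsWithin (0 : ℝ) (Set.Ioi 0),
          f i y - c i + ε * (f i z - f i y) ≠ 0 :=
        eventually_add_mul_ne_zero _ (by rw [hyi]; exact sub_ne_zero.2 hzi)
      have h3 : ∀ᶠ ε in nhdsWithin (0 : ℝ) (Set.Ioi 0), ε ∈ Set.Icc (0 : ℝ) 1 :=
        Icc_mem_nhdsGT zero_lt_one
      obtain ⟨ε, ⟨h1, h2⟩, h3⟩ := ((h1.and h2).and h3).exists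
      refine ⟨y + ε • (z - y), hC.add_smul_sub_mem hy hz h3, ?_⟩
      have hval : ∀ j, f j (y + ε • (z - y)) - c j = f j y - c j + ε * (f j z - f j y) := by
        intro j; simp only [map_add, map_smul, map_sub, smul_eq_mul]; ring
      intro j hj h0
      rw [← sub_eq_zero, hval] at h0
      rcases Finset.mem_insert.1 hj with rfl | hj
      · exact h2 h0
      · have := h1 j hj
        rw [h0, mul_zero] at this
        exact lt_irrefl _ this
    · refine ⟨y, hy, fun j hj => ?_⟩
      rcases Finset.mem_insert.1 hj with rfl | hj
      · exact hyi
      · exact hys j hj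

/-- A finite family of symmetric-faced convex bodies with union `P`, pairwise separated by
hyperplanes not containing `P`. -/
structure IsSeparatedTiling (P : Set E) (𝒯 : Set (Set E)) : Prop where
  finite : 𝒯.Finite
  sUnion_eq : ⋃₀ 𝒯 = P
  isCompact : ∀ T ∈ 𝒯, IsCompact T
  convex : ∀ T ∈ 𝒯, Convex ℝ T
  symmetric : ∀ T ∈ 𝒯, ∀ w : StrongDual ℝ E, ∃ s, ∀ x ∈ w.toExposed T, s - x ∈ w.toExposed T
  separated : ∀ S ∈ 𝒯, ∀ T ∈ 𝒯, S ≠ T → ∃ (f : StrongDual ℝ E) (c : ℝ),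
    (∀ x ∈ S, f x ≤ c) ∧ (∀ x ∈ T, c ≤ f x) ∧ ∃ y ∈ P, f y ≠ c

theorem image_toExposed_eq_fiber {F : Set E} {d θ : StrongDual ℝ E} {z : E} (hz : z ∈ F)
    (hmax : ∀ y ∈ F, d y ≤ d z) :
    θ '' d.toExposed F = {t : ℝ | (d z, t) ∈ d.prod θ '' F} := by
  ext t
  constructor
  · rintro ⟨x, ⟨hx, hxm⟩, rfl⟩
    exact ⟨x, hx, Prod.ext (le_antisymm (hmax x hx) (hxm z hz)) rfl⟩
  · rintro ⟨x, hx, h⟩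
    have h1 : d x = d z := congrArg Prod.fst h
    have h2 : θ x = t := congrArg Prod.snd h
    exact ⟨x, ⟨hx, fun y hy => h1 ▸ hmax y hy⟩, h2⟩

/-- In a polygonal face of a tiled polytope, two opposite parallel edges have the same length. -/
theorem IsSeparatedTiling.volume_edge_eq {P : Set E} {𝒯 : Set (Set E)}
    (h𝒯 : IsSeparatedTiling P 𝒯) (hP : IsCompact P) (hPc : Convex ℝ P) (hPne : P.Nonempty)
    {w d θ : StrongDual ℝ E} {l m : E} (hdl : d l = 0) (hdm : d m ≠ 0) (hθ : θ l ≠ 0)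
    (hF : ∀ x ∈ w.toExposed P, ∀ y ∈ w.toExposed P, ∃ α β : ℝ, x - y = α • l + β • m) :
    MeasureTheory.volume.real (θ '' d.toExposed (w.toExposed P)) =
      MeasureTheory.volume.real (θ '' (-d).toExposed (w.toExposed P)) := by
  classical
  set F := w.toExposed P with hFdef
  have hFexp : IsExposed ℝ P F := ContinuousLinearMap.toExposed.isExposed
  have hFcomp : IsCompact F := hFexp.isCompact hP
  have hFconv : Convex ℝ F := hFexp.convex hPc
  have hFne : F.Nonempty := by
    obtain ⟨z, hz, hmax⟩ := hP.exists_isMaxOn hPne w.continuous.continuousOn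
    exact ⟨z, hz, fun y hy => hmax hy⟩
  have hinj : ∀ x ∈ F, ∀ y ∈ F, d x = d y → θ x = θ y → x = y := by
    intro x hx y hy h1 h2
    obtain ⟨α, β, h⟩ := hF x hx y hy
    have hd := congrArg d h
    have ht := congrArg θ h
    simp only [map_sub, map_add, map_smul, smul_eq_mul, hdl, h1, h2, sub_self, mul_zero,
      zero_add] at hd ht
    have hβ : β = 0 := (mul_eq_zero.1 hd.symm).resolve_right hdm
    rw [hβ, zero_mul, add_zero] at ht
    have hα : α = 0 := (mul_eq_zero.1 ht.symm).resolve_right hθ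
    rw [hα, hβ, zero_smul, zero_smul, add_zero] at h
    exact sub_eq_zero.1 h
  -- separating hyperplanes and a point of `P` on none of them
  have hfin : Finite 𝒯 := h𝒯.finite
  choose f c hfS hfT hfP using fun p : {p : 𝒯 × 𝒯 // (p.1 : Set E) ≠ p.2} =>
    h𝒯.separated p.1.1 p.1.1.2 p.1.2 p.1.2.2 p.2
  obtain ⟨y₀, hy₀, hgen⟩ := hPc.exists_forall_ne hPne f c hfP
  -- Only tiles entered when moving from a point of `F` towards the generic `y₀` are kept. They
  -- still cover `F`, and no separating hyperplane of two of them contains `F`.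
  let A : Set (Set E) :=
    {T ∈ 𝒯 | ∃ z ∈ T, z ∈ F ∧ ∃ ε : ℝ, 0 < ε ∧ z + ε • (y₀ - z) ∈ T}
  have hAfin : A.Finite := h𝒯.finite.subset fun T hT => hT.1
  have := hAfin.fintype
  have hTP : ∀ T ∈ 𝒯, T ⊆ P := fun T hT => h𝒯.sUnion_eq ▸ Set.subset_sUnion_of_mem hT
  have hface : ∀ T ∈ A, T ∩ F = w.toExposed T := by
    rintro T ⟨hT, z, hzT, hzF, -⟩
    ext x
    constructor
    · rintro ⟨hxT, hxF⟩
      exact ⟨hxT, fun y hy => hxF.2 y (hTP T hT hy)⟩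
    · rintro ⟨hxT, hmax⟩
      exact ⟨hxT, hTP T hT hxT, fun y hy => (hzF.2 y hy).trans (hmax z hzT)⟩
  have hcover : F = ⋃ T : A, (T : Set E) ∩ F := by
    refine Set.Subset.antisymm (fun z hz => ?_) (Set.iUnion_subset fun T => Set.inter_subset_right)
    have hev : ∀ᶠ ε in nhdsWithin (0 : ℝ) (Set.Ioi 0), ε ∈ Set.Icc (0 : ℝ) 1 :=
      Icc_mem_nhdsGT zero_lt_one
    -- Finitely many tiles cover the segment, so one contains points of it arbitrarily close to `z`,
    -- and `z` itself by closedness.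
    have hfr : ∃ T ∈ 𝒯, ∃ᶠ ε in nhdsWithin (0 : ℝ) (Set.Ioi 0), z + ε • (y₀ - z) ∈ T := by
      by_contra! hno
      have hno' : ∀ᶠ ε in nhdsWithin (0 : ℝ) (Set.Ioi 0), ∀ T ∈ 𝒯, z + ε • (y₀ - z) ∉ T :=
        (Filter.eventually_all_finite h𝒯.finite).2 fun T hT => by simpa using hno T hT
      obtain ⟨ε, h1, h2⟩ := (hno'.and hev).exists
      have h3 : z + ε • (y₀ - z) ∈ P := hPc.add_smul_sub_mem hz.1 hy₀ h2
      rw [← h𝒯.sUnion_eq] at h3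
      obtain ⟨T, hT, h4⟩ := h3
      exact h1 T hT h4
    obtain ⟨T, hT, hfr⟩ := hfr
    have hzT : z ∈ T := by
      have hcont : Continuous fun ε : ℝ => z + ε • (y₀ - z) := by fun_prop
      have htend : Filter.Tendsto (fun ε : ℝ => z + ε • (y₀ - z))
          (nhdsWithin 0 (Set.Ioi 0)) (nhds z) := by
        simpa using (hcont.tendsto 0).mono_left nhdsWithin_le_nhds
      exact (h𝒯.isCompact T hT).isClosed.mem_of_frequently_of_tendsto hfr htend
    obtain ⟨ε, h1, h2⟩ := (hfr.and_eventually self_mem_nhdsWithin).exists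
    exact Set.mem_iUnion.2 ⟨⟨T, hT, z, hzT, hz, ε, h2, h1⟩, hzT, hz⟩
  let Φ : E →L[ℝ] ℝ × ℝ := d.prod θ
  -- The abscissae of separating lines parallel to `l`; any other separating line meets each slice
  -- at most once.
  let B : Set ℝ := ⋃ p : {p : 𝒯 × 𝒯 // (p.1 : Set E) ≠ p.2},
    d '' {x ∈ F | f p x = c p ∧ f p l = 0 ∧ f p m ≠ 0}
  have hB : B.Finite := by
    refine Set.finite_iUnion fun p => Set.Subsingleton.finite ?_
    rintro _ ⟨x, ⟨hx, hxc, hl, hm⟩, rfl⟩ _ ⟨y, ⟨hy, hyc, -, -⟩, rfl⟩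
    obtain ⟨α, β, h⟩ := hF x hx y hy
    have h1 := congrArg (f p) h
    simp only [map_sub, map_add, map_smul, smul_eq_mul, hxc, hyc, hl, sub_self, mul_zero,
      zero_add] at h1
    have hβ : β = 0 := (mul_eq_zero.1 h1.symm).resolve_right hm
    have h2 := congrArg d h
    simp only [map_sub, map_add, map_smul, smul_eq_mul, hdl, hβ] at h2
    linarith
  have hdis : ∀ r ∉ B, ∀ S T : A, S ≠ T →
      {t : ℝ | (r, t) ∈ Φ '' ((S : Set E) ∩ F) ∩ Φ '' ((T : Set E) ∩ F)}.Subsingleton := by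
    intro r hr S T hST
    have hST' : (S : Set E) ≠ T := fun h => hST (Subtype.ext h)
    let p : {p : 𝒯 × 𝒯 // (p.1 : Set E) ≠ p.2} := ⟨(⟨S, S.2.1⟩, ⟨T, T.2.1⟩), hST'⟩
    have hpt : ∀ t, (r, t) ∈ Φ '' ((S : Set E) ∩ F) ∩ Φ '' ((T : Set E) ∩ F) →
        ∃ x ∈ F, f p x = c p ∧ d x = r ∧ θ x = t := by
      rintro t ⟨⟨x, ⟨hxS, hxF⟩, hx⟩, ⟨y, ⟨hyT, hyF⟩, hy⟩⟩
      have hx1 : d x = r := congrArg Prod.fst hx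
      have hx2 : θ x = t := congrArg Prod.snd hx
      have hy1 : d y = r := congrArg Prod.fst hy
      have hy2 : θ y = t := congrArg Prod.snd hy
      have hxy : x = y := hinj x hxF y hyF (hx1.trans hy1.symm) (hx2.trans hy2.symm)
      exact ⟨x, hxF, le_antisymm (hfS p x hxS) (hfT p x (hxy ▸ hyT)), hx1, hx2⟩
    intro t ht t' ht'
    obtain ⟨x, hxF, hxc, hxr, rfl⟩ := hpt t ht
    obtain ⟨y, hyF, hyc, hyr, rfl⟩ := hpt t' ht'
    obtain ⟨α, β, h⟩ := hF x hxF y hyF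
    have h1 := congrArg d h
    simp only [map_sub, map_add, map_smul, smul_eq_mul, hdl, hxr, hyr, sub_self, mul_zero,
      zero_add] at h1
    have hβ : β = 0 := (mul_eq_zero.1 h1.symm).resolve_right hdm
    have h2 := congrArg (f p) h
    simp only [map_sub, map_add, map_smul, smul_eq_mul, hxc, hyc, hβ, sub_self, zero_mul,
      add_zero] at h2
    rcases mul_eq_zero.1 h2.symm with hα | hl
    · rw [hα, hβ, zero_smul, zero_smul, add_zero, sub_eq_zero] at h
      rw [h]
    -- If the hyperplane contained `F`, the two tiles entered towards `y₀` would force `f p y₀ = c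
    -- p`, against the choice of `y₀`.
    by_cases hm : f p m = 0
    · exfalso
      have hconst : ∀ z ∈ F, f p z = c p := by
        intro z hz
        obtain ⟨α', β', h'⟩ := hF z hz x hxF
        have h3 := congrArg (f p) h'
        simp only [map_sub, map_add, map_smul, smul_eq_mul, hl, hm, hxc] at h3
        linarith
      obtain ⟨-, z, -, hzF, ε, hε, hzε⟩ := S.2
      obtain ⟨-, z', -, hzF', ε', hε', hzε'⟩ := T.2
      have h4 := hfS p _ hzε
      have h5 := hfT p _ hzε'
      simp only [map_add, map_smul, map_sub, smul_eq_mul, hconst z hzF, hconst z' hzF'] at h4 h5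
      refine hgen p (le_antisymm ?_ ?_)
      · have : ε * (f p y₀ - c p) ≤ 0 := by linarith
        nlinarith
      · have : 0 ≤ ε' * (f p y₀ - c p) := by linarith
        nlinarith
    · exact absurd (Set.mem_iUnion_of_mem p ⟨x, ⟨hxF, hxc, hl, hm⟩, hxr⟩ : r ∈ B) hr
  have hKne : (Φ '' F).Nonempty := hFne.image _
  have hKcomp : IsCompact (Φ '' F) := hFcomp.image Φ.continuous
  have hKconv : Convex ℝ (Φ '' F) := hFconv.is_linear_image Φ.isLinear
  obtain ⟨p, q, hpq, hI⟩ := exists_fst_image_eq_Icc hKcomp hKconv hKne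
  have hTexp : ∀ T : A, IsExposed ℝ (T : Set E) (T ∩ F) := fun T => by
    rw [hface T T.2]; exact ContinuousLinearMap.toExposed.isExposed
  have hmain := fiberLength_eq_of_tiling (T := fun T : A => Φ '' ((T : Set E) ∩ F)) hKcomp hKconv
    (fun T => ((hTexp T).isCompact (h𝒯.isCompact T T.2.1)).image Φ.continuous)
    (fun T => ((hTexp T).convex (h𝒯.convex T T.2.1)).is_linear_image Φ.isLinear)
    (fun T => by
      obtain ⟨-, z, hzT, hzF, -⟩ := T.2
      exact ⟨_, z, ⟨hzT, hzF⟩, rfl⟩)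
    (fun T => by
      obtain ⟨s, hs⟩ := h𝒯.symmetric T T.2.1 w
      refine ⟨Φ s, ?_⟩
      rw [hface T T.2]
      rintro _ ⟨x, hx, rfl⟩
      exact ⟨s - x, hs x hx, map_sub Φ s x⟩)
    (by rw [← Set.image_iUnion, ← hcover]) hB hdis hpq hI
  have hmem : ∀ x ∈ F, d x ∈ Set.Icc p q := fun x hx =>
    hI ▸ Set.mem_image_of_mem Prod.fst (Set.mem_image_of_mem Φ hx)
  have hends : ∀ r ∈ Set.Icc p q, ∃ z ∈ F, d z = r := by
    intro r hr
    have hr' : r ∈ Prod.fst '' (Φ '' F) := hI ▸ hr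
    obtain ⟨_, ⟨z, hz, rfl⟩, h⟩ := hr'
    exact ⟨z, hz, h⟩
  obtain ⟨zp, hzp, hdp⟩ := hends p ⟨le_rfl, hpq⟩
  obtain ⟨zq, hzq, hdq⟩ := hends q ⟨hpq, le_rfl⟩
  rw [image_toExposed_eq_fiber hzq fun y hy => hdq.symm ▸ (hmem y hy).2,
    image_toExposed_eq_fiber hzp fun y hy => by
      simpa [hdp] using (hmem y hy).1]
  have hneg : {t : ℝ | ((-d) zp, t) ∈ (-d).prod θ '' F} = {t : ℝ | (d zp, t) ∈ Φ '' F} := by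
    ext t
    simp [Φ, Prod.ext_iff]
  rw [hneg, hdp, hdq]
  exact hmain.symm

end Faces

/-! ### Equal length of parallel edges -/

section Edges

variable {E : Type*} [NormedAddCommGroup E] [NormedSpace ℝ E]

/-- The points of `s` at which `w` attains its maximum over `s`. -/
def maximizers (s : Set E) (w : StrongDual ℝ E) : Set E := {p ∈ s | ∀ q ∈ s, w q ≤ w p}

theorem maximizers_nonempty {s : Set E} (hs : s.Finite) (hne : s.Nonempty) (w : StrongDual ℝ E) :
    (maximizers s w).Nonempty := by
  obtain ⟨p, hp, hmax⟩ := Set.exists_max_image s w hs hne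
  exact ⟨p, hp, hmax⟩

theorem maximizers_subset_toExposed {s : Set E} (w : StrongDual ℝ E) :
    maximizers s w ⊆ w.toExposed (convexHull ℝ s) := by
  rintro p ⟨hp, hmax⟩
  refine ⟨subset_convexHull ℝ s hp, fun y hy => ?_⟩
  exact (convexHull_min (fun q hq => hmax q hq) (convex_halfSpace_le w.isLinear (w p)) hy :
    y ∈ {y | w y ≤ w p})

theorem toExposed_convexHull {s : Set E} (hs : s.Finite) (w : StrongDual ℝ E) :
    w.toExposed (convexHull ℝ s) = convexHull ℝ (maximizers s w) := by
  have hexp : IsExposed ℝ (convexHull ℝ s) (w.toExposed (convexHull ℝ s)) :=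
    ContinuousLinearMap.toExposed.isExposed
  have hcomp := hexp.isCompact (hs.isCompact_convexHull (𝕜 := ℝ))
  have hconv := hexp.convex (convex_convexHull ℝ s)
  apply Set.Subset.antisymm
  · rw [← closure_convexHull_extremePoints hcomp hconv]
    refine closure_minimal (convexHull_mono ?_)
      ((hs.subset fun p hp => hp.1).isCompact_convexHull (𝕜 := ℝ)).isClosed
    intro x hx
    have hxs : x ∈ s := extremePoints_convexHull_subset
      (hexp.isExtreme.extremePoints_subset_extremePoints hx)
    exact ⟨hxs, fun q hq => hx.1.2 q (subset_convexHull ℝ s hq)⟩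
  · exact convexHull_min (maximizers_subset_toExposed w) hconv

/-- The hypothesis says that `u` is a small perturbation of `w` as far as differences in `s` are
concerned, so `u` only breaks the ties left by `w`. -/
theorem maximizers_maximizers {s : Set E} (hs : s.Finite) (hne : s.Nonempty)
    {u w : StrongDual ℝ E}
    (h : ∀ p ∈ s, ∀ q ∈ s, w (p - q) ≠ 0 → 0 < w (p - q) * u (p - q)) :
    maximizers s u = maximizers (maximizers s w) u := by
  have hsub : maximizers s u ⊆ maximizers s w := by
    rintro p ⟨hp, hmax⟩
    refine ⟨hp, fun q hq => ?_⟩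
    by_contra! hlt
    have h1 := h p hp q hq (by rw [map_sub]; linarith)
    have h2 := hmax q hq
    simp only [map_sub] at h1
    nlinarith
  refine Set.Subset.antisymm (fun p hp => ⟨hsub hp, fun q hq => hp.2 q hq.1⟩) ?_
  rintro p ⟨hp, hmax⟩
  refine ⟨hp.1, fun q hq => ?_⟩
  obtain ⟨r, hr⟩ := maximizers_nonempty hs hne u
  exact (hr.2 q hq).trans (hmax r (hsub hr))

theorem toExposed_toExposed {s : Set E} (hs : s.Finite) (hne : s.Nonempty)
    {u w : StrongDual ℝ E}
    (h : ∀ p ∈ s, ∀ q ∈ s, w (p - q) ≠ 0 → 0 < w (p - q) * u (p - q)) :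
    u.toExposed (convexHull ℝ s) = u.toExposed (w.toExposed (convexHull ℝ s)) := by
  rw [toExposed_convexHull hs, maximizers_maximizers hs hne h, toExposed_convexHull hs w,
    toExposed_convexHull (hs.subset fun p hp => hp.1)]

theorem sub_mem_of_mem_convexHull {s : Set E} {V : Submodule ℝ E}
    (h : ∀ p ∈ s, ∀ q ∈ s, p - q ∈ V) :
    ∀ x ∈ convexHull ℝ s, ∀ y ∈ convexHull ℝ s, x - y ∈ V := by
  have hconv : ∀ y : E, Convex ℝ {x | x - y ∈ V} := by
    intro y a ha b hb α β _ _ hαβ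
    have : α • a + β • b - y = α • (a - y) + β • (b - y) := by
      rw [smul_sub, smul_sub, sub_add_sub_comm, ← add_smul, hαβ, one_smul]
    change α • a + β • b - y ∈ V
    rw [this]
    exact V.add_mem (V.smul_mem _ ha) (V.smul_mem _ hb)
  have h1 : ∀ x ∈ convexHull ℝ s, ∀ q ∈ s, x - q ∈ V := fun x hx q hq =>
    (convexHull_min (fun p hp => h p hp q hq) (hconv q) hx : x ∈ {x | x - q ∈ V})
  intro x hx y hy
  have := (convexHull_min (fun q hq => by
    have := V.neg_mem (h1 x hx q hq); rwa [neg_sub] at this) (hconv x) hy : y ∈ {y | y - x ∈ V})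
  have := V.neg_mem this
  rwa [neg_sub] at this

/-- Only the values on differences of points of `F`, up to a positive factor, decide which face is
exposed. -/
theorem toExposed_congr {F : Set E} {u v : StrongDual ℝ E} {κ : ℝ} (hκ : 0 < κ)
    (h : ∀ x ∈ F, ∀ y ∈ F, v (x - y) = κ * u (x - y)) : v.toExposed F = u.toExposed F := by
  ext x
  refine and_congr_right fun hx => forall₂_congr fun y hy => ?_
  have := h x hx y hy
  simp only [map_sub] at this
  rw [← sub_nonneg, this, mul_nonneg_iff_of_pos_left hκ, sub_nonneg]

theorem toExposed_eq_self {F : Set E} {u : StrongDual ℝ E}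
    (h : ∀ x ∈ F, ∀ y ∈ F, u (x - y) = 0) : u.toExposed F = F := by
  refine Set.Subset.antisymm (fun x hx => hx.1) fun x hx => ⟨hx, fun y hy => ?_⟩
  have := h x hx y hy
  rw [map_sub] at this
  linarith

variable [FiniteDimensional ℝ E]

/-- The evaluation at a vector, as a functional on the annihilator of `l`. -/
noncomputable def evalOnAnnihilator (l a : E) :
    Module.Dual ℝ (LinearMap.ker (ContinuousLinearMap.apply ℝ ℝ l : StrongDual ℝ E →ₗ[ℝ] ℝ)) :=
  (ContinuousLinearMap.apply ℝ ℝ a : StrongDual ℝ E →ₗ[ℝ] ℝ).comp (Submodule.subtype _)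

/-- In a tiled polytope, all edges of a given direction have the same length. -/
theorem IsSeparatedTiling.exists_edge_length {s : Set E} (hs : s.Finite) (hne : s.Nonempty)
    {𝒯 : Set (Set E)} (h𝒯 : IsSeparatedTiling (convexHull ℝ s) 𝒯) {l : E}
    {θ : StrongDual ℝ E} (hθ : θ l ≠ 0) :
    ∃ L : ℝ, 0 ≤ L ∧ ∀ w : StrongDual ℝ E, w l = 0 →
      (∀ p ∈ s, ∀ q ∈ s, w (p - q) = 0 → p - q ∈ Submodule.span ℝ {l}) →
      MeasureTheory.volume.real (θ '' w.toExposed (convexHull ℝ s)) = L := by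
  -- In the annihilator of `l`, a functional off all these walls exposes a face parallel to `l`,
  -- possibly a single point.
  let A : Set (Module.Dual ℝ
      (LinearMap.ker (ContinuousLinearMap.apply ℝ ℝ l : StrongDual ℝ E →ₗ[ℝ] ℝ))) :=
    (fun z : E × E => evalOnAnnihilator l (z.1 - z.2)) ''
      {z ∈ s ×ˢ s | z.1 - z.2 ∉ Submodule.span ℝ {l}}
  have hA : A.Finite := ((hs.prod hs).subset fun z hz => hz.1).image _
  have hAmem : ∀ p ∈ s, ∀ q ∈ s, p - q ∉ Submodule.span ℝ {l} →
      evalOnAnnihilator l (p - q) ∈ A := fun p hp q hq h => ⟨(p, q), ⟨⟨hp, hq⟩, h⟩, rfl⟩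
  have hspan : ∀ (w : StrongDual ℝ E) (x : E), w l = 0 → x ∈ Submodule.span ℝ {l} → w x = 0 := by
    intro w x hw hx
    obtain ⟨c, rfl⟩ := Submodule.mem_span_singleton.1 hx
    rw [map_smul, hw, smul_zero]
  have key : ∀ u v : LinearMap.ker (ContinuousLinearMap.apply ℝ ℝ l : StrongDual ℝ E →ₗ[ℝ] ℝ),
      (∀ a ∈ A, a u ≠ 0) → (∀ a ∈ A, a v ≠ 0) →
      MeasureTheory.volume.real (θ '' (u : StrongDual ℝ E).toExposed (convexHull ℝ s)) =
      MeasureTheory.volume.real (θ '' (v : StrongDual ℝ E).toExposed (convexHull ℝ s)) := by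
    intro u v hu hv
    refine eq_of_forall_adjacent_eq hA (fun u => MeasureTheory.volume.real
      (θ '' (u : StrongDual ℝ E).toExposed (convexHull ℝ s))) ?_ hu hv
    clear hu hv u v
    rintro ⟨u, hul⟩ ⟨v, hvl⟩ ⟨w, hwl⟩ hu hv hw hprop
    have hul : u l = 0 := hul
    have hvl : v l = 0 := hvl
    have hwl : w l = 0 := hwl
    have hsign : ∀ p ∈ s, ∀ q ∈ s, w (p - q) ≠ 0 →
        0 < w (p - q) * u (p - q) ∧ 0 < w (p - q) * v (p - q) := by
      intro p hp q hq h0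
      exact hw _ (hAmem p hp q hq fun h => h0 (hspan w _ hwl h)) h0
    dsimp only
    rw [toExposed_toExposed hs hne fun p hp q hq h0 => (hsign p hp q hq h0).1,
      toExposed_toExposed hs hne fun p hp q hq h0 => (hsign p hp q hq h0).2]
    have htop : ∀ p ∈ maximizers s w, ∀ q ∈ maximizers s w, w (p - q) = 0 := by
      intro p hp q hq
      rw [map_sub, sub_eq_zero]
      exact le_antisymm (hq.2 p hp.1) (hp.2 q hq.1)
    by_cases hline : ∀ p ∈ maximizers s w, ∀ q ∈ maximizers s w, p - q ∈ Submodule.span ℝ {l}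
    · have hd := sub_mem_of_mem_convexHull hline
      rw [← toExposed_convexHull hs] at hd
      rw [toExposed_eq_self fun x hx y hy => hspan u _ hul (hd x hx y hy),
        toExposed_eq_self fun x hx y hy => hspan v _ hvl (hd x hx y hy)]
    push Not at hline
    obtain ⟨p₀, hp₀, q₀, hq₀, hm⟩ := hline
    set m := p₀ - q₀ with hmdef
    have hmA : evalOnAnnihilator l m ∈ A := hAmem p₀ hp₀.1 q₀ hq₀.1 hm
    have hum : u m ≠ 0 := hu _ hmA
    have hvm : v m ≠ 0 := hv _ hmA
    -- All walls through `w` are proportional on the annihilator of `l`, so a difference in the face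
    -- of `w` is a multiple of `m` up to a multiple of `l`; that face is at most a polygon.
    have hplane : ∀ p ∈ maximizers s w, ∀ q ∈ maximizers s w,
        p - q ∈ Submodule.span ℝ {l, m} := by
      intro p hp q hq
      by_cases hpq : p - q ∈ Submodule.span ℝ {l}
      · exact Submodule.span_mono (by simp) hpq
      obtain ⟨c, hc⟩ := hprop _ hmA _ (hAmem p hp.1 q hq.1 hpq) (htop p₀ hp₀ q₀ hq₀)
        (htop p hp q hq)
      have hmem : p - q - c • m ∈ Submodule.span ℝ {l} := by
        by_contra hnot
        obtain ⟨d, hd, hdne⟩ := exists_strongDual_ne_zero_of_notMem hnot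
        have hdl : d l = 0 := hd l (Submodule.mem_span_singleton_self l)
        have h1 : d (p - q) = c * d m := LinearMap.congr_fun hc ⟨d, hdl⟩
        exact hdne (by rw [map_sub, h1, map_smul, smul_eq_mul, sub_self])
      have h2 := Submodule.add_mem _ (Submodule.span_mono (by simp) hmem :
        p - q - c • m ∈ Submodule.span ℝ {l, m})
        (Submodule.smul_mem _ c (Submodule.subset_span (by simp : m ∈ ({l, m} : Set E))))
      rwa [sub_add_cancel] at h2
    have hd := sub_mem_of_mem_convexHull hplane
    rw [← toExposed_convexHull hs] at hd
    have hF : ∀ x ∈ w.toExposed (convexHull ℝ s), ∀ y ∈ w.toExposed (convexHull ℝ s),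
        ∃ α β : ℝ, x - y = α • l + β • m := by
      intro x hx y hy
      obtain ⟨α, β, h⟩ := Submodule.mem_span_pair.1 (hd x hx y hy)
      exact ⟨α, β, h.symm⟩
    -- On this face `u` and `v` are determined by their values at `m`: opposite signs select
    -- opposite edges, equal signs the same edge.
    rcases (mul_ne_zero hum hvm).lt_or_gt with hneg | hpos
    · have hκ : 0 < v m / (-u m) := by
        rcases hum.lt_or_gt with h | h
        · exact div_pos (by nlinarith) (by linarith)
        · exact div_pos_of_neg_of_neg (by nlinarith) (by linarith)
      rw [toExposed_congr (v := v) (u := -u) hκ]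
      · exact h𝒯.volume_edge_eq (hs.isCompact_convexHull (𝕜 := ℝ)) (convex_convexHull ℝ s)
          (hne.convexHull) hul hum hθ hF
      · intro x hx y hy
        obtain ⟨α, β, h⟩ := hF x hx y hy
        rw [h]
        simp only [map_add, map_smul, neg_apply, smul_eq_mul, hul, hvl]
        field_simp
        ring
    · have hκ : 0 < v m / u m := by
        rcases hum.lt_or_gt with h | h
        · exact div_pos_of_neg_of_neg (by nlinarith) h
        · exact div_pos (by nlinarith) h
      rw [toExposed_congr (v := v) (u := u) hκ]
      intro x hx y hy
      obtain ⟨α, β, h⟩ := hF x hx y hy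
      rw [h]
      simp only [map_add, map_smul, smul_eq_mul, hul, hvl]
      field_simp
      ring
  have hgen : ∀ w : StrongDual ℝ E, ∀ hw : w l = 0,
      (∀ p ∈ s, ∀ q ∈ s, w (p - q) = 0 → p - q ∈ Submodule.span ℝ {l}) →
      ∀ a ∈ A, a ⟨w, hw⟩ ≠ 0 := by
    rintro w hw h _ ⟨⟨p, q⟩, ⟨⟨hp, hq⟩, hpq⟩, rfl⟩ h0
    exact hpq (h p hp q hq h0)
  by_cases hex : ∃ w : StrongDual ℝ E, w l = 0 ∧
      ∀ p ∈ s, ∀ q ∈ s, w (p - q) = 0 → p - q ∈ Submodule.span ℝ {l}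
  · obtain ⟨w₀, hw₀, hg₀⟩ := hex
    exact ⟨_, MeasureTheory.measureReal_nonneg, fun w hw hg =>
      key ⟨w, hw⟩ ⟨w₀, hw₀⟩ (hgen w hw hg) (hgen w₀ hw₀ hg₀)⟩
  · exact ⟨0, le_rfl, fun w hw hg => absurd ⟨w, hw, hg⟩ hex⟩

end Edges

/-! ### Reconstructing the zonotope from its edge lengths -/

section ZonotopeOfTiling

variable {E : Type*} [NormedAddCommGroup E] [NormedSpace ℝ E]

/-- A finite set of vectors contains exactly one representative of every direction. -/
theorem exists_direction_representatives {D : Set E} (hD : ∀ x ∈ D, x ≠ 0) :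
    ∃ R ⊆ D, (∀ x ∈ D, ∃ l ∈ R, x ∈ Submodule.span ℝ {l}) ∧
      ∀ l ∈ R, ∀ l' ∈ R, l' ∈ Submodule.span ℝ {l} → l' = l := by
  obtain ⟨R, hRD, hR⟩ := (Set.surjOn_image (fun x : E => Submodule.span ℝ {x}) D).exists_bijOn_subset
  refine ⟨R, hRD, fun x hx => ?_, fun l hl l' hl' h => ?_⟩
  · obtain ⟨l, hl, h⟩ := hR.surjOn ⟨x, hx, rfl⟩
    exact ⟨l, hl, (show Submodule.span ℝ {l} = Submodule.span ℝ {x} from h) ▸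
      Submodule.mem_span_singleton_self x⟩
  · refine hR.injOn hl' hl ?_
    obtain ⟨c, rfl⟩ := Submodule.mem_span_singleton.1 h
    have hc : c ≠ 0 := fun h0 => hD _ (hRD hl') (by rw [h0, zero_smul])
    exact Submodule.span_singleton_smul_eq (IsUnit.mk0 c hc) l

/-- A functional on a compact set bounded away from its value at `x` can be perturbed to one that
does not vanish on any of finitely many given nonzero vectors. -/
theorem exists_generic_separation [FiniteDimensional ℝ E] {D : Set E} (hDfin : D.Finite)
    (hD : ∀ x ∈ D, x ≠ 0) {K : Set E} (hK : IsCompact K) (hKc : Convex ℝ K) {x : E}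
    (hx : x ∉ K) : ∃ w : StrongDual ℝ E, (∀ a ∈ D, w a ≠ 0) ∧ ∀ y ∈ K, w y < w x := by
  obtain ⟨w₀, r, hw₀, hr⟩ := geometric_hahn_banach_closed_point hKc hK.isClosed hx
  have : Finite D := hDfin
  obtain ⟨z, hz⟩ := Module.Dual.exists_forall_ne_zero_of_forall_exists (K := ℝ)
    (M := StrongDual ℝ E)
    (fun a : D => (ContinuousLinearMap.apply ℝ ℝ (a : E) : StrongDual ℝ E →ₗ[ℝ] ℝ)) (by
      rintro ⟨a, ha⟩
      obtain ⟨d, -, hd⟩ := exists_strongDual_ne_zero_of_notMem (p := (⊥ : Submodule ℝ E))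
        (v := a) (by simpa using hD a ha)
      exact ⟨d, hd⟩)
  obtain ⟨M, hM⟩ := (hK.image z.continuous).bddAbove
  have h1 : ∀ᶠ ε in nhdsWithin (0 : ℝ) (Set.Ioi 0), ∀ a ∈ D, w₀ a + ε * z a ≠ 0 :=
    (Filter.eventually_all_finite hDfin).2 fun a ha => eventually_add_mul_ne_zero _ (hz ⟨a, ha⟩)
  have h2 : ∀ᶠ ε in nhdsWithin (0 : ℝ) (Set.Ioi 0), r + ε * M < w₀ x + ε * z x := by
    have hc : Continuous fun ε : ℝ => w₀ x + ε * z x - (r + ε * M) := by fun_prop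
    have h0 : 0 < w₀ x + 0 * z x - (r + 0 * M) := by linarith
    filter_upwards [((hc.tendsto 0).eventually_const_lt h0).filter_mono nhdsWithin_le_nhds]
      with ε hε
    linarith
  obtain ⟨ε, ⟨h1, h2⟩, h3⟩ := ((h1.and h2).and self_mem_nhdsWithin).exists
  have h3 : 0 < ε := h3
  refine ⟨w₀ + ε • z, fun a ha => by simpa using h1 a ha, fun y hy => ?_⟩
  have h4 := mul_le_mul_of_nonneg_left (hM ⟨y, hy, rfl⟩) h3.le
  have h5 := hw₀ y hy
  simp only [add_apply, smul_apply, smul_eq_mul]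
  linarith

/-- The endpoints of a segment parallel to `l` in terms of its length. -/
theorem exists_endpoints {F : Set E} (hF : IsCompact F) (hFc : Convex ℝ F) (hne : F.Nonempty)
    {l : E} {θ : StrongDual ℝ E} (hθ : θ l = 1)
    (hline : ∀ x ∈ F, ∀ y ∈ F, x - y ∈ Submodule.span ℝ {l}) :
    ∃ x₀, ∀ (u : StrongDual ℝ E) (x : E), u l ≠ 0 → x ∈ u.toExposed F →
      x = x₀ + (if 0 < u l then MeasureTheory.volume.real (θ '' F) else 0) • l := by
  have hI := eq_Icc_of_connected_compact
    ⟨hne.image θ, hFc.isPreconnected.image _ θ.continuous.continuousOn⟩ (hF.image θ.continuous)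
  set a := sInf (θ '' F)
  set b := sSup (θ '' F)
  have hab : a ≤ b := by
    have := hne.image θ
    rw [hI] at this
    exact Set.nonempty_Icc.1 this
  have hbd : ∀ x ∈ F, a ≤ θ x ∧ θ x ≤ b := fun x hx =>
    (hI ▸ Set.mem_image_of_mem θ hx : θ x ∈ Set.Icc a b)
  obtain ⟨xa, hxa, hθa⟩ : a ∈ θ '' F := hI ▸ ⟨le_rfl, hab⟩
  obtain ⟨xb, hxb, hθb⟩ : b ∈ θ '' F := hI ▸ ⟨hab, le_rfl⟩
  have hdiff : ∀ x ∈ F, ∀ y ∈ F, x - y = (θ x - θ y) • l := by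
    intro x hx y hy
    obtain ⟨c, hc⟩ := Submodule.mem_span_singleton.1 (hline x hx y hy)
    rw [← map_sub, ← hc, map_smul, hθ, smul_eq_mul, mul_one]
  refine ⟨xa, fun u x hul hx => ?_⟩
  rw [hI, Real.volume_real_Icc_of_le hab, ← sub_eq_iff_eq_add', hdiff x hx.1 xa hxa, hθa]
  congr 1
  have h1 := hbd x hx.1
  split_ifs with hpos
  · have h2 := hx.2 xb hxb
    rw [← sub_nonneg, ← map_sub, hdiff x hx.1 xb hxb, map_smul, smul_eq_mul,
      mul_nonneg_iff_of_pos_right hpos] at h2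
    linarith
  · have h2 := hx.2 xa hxa
    rw [← sub_nonneg, ← map_sub, hdiff x hx.1 xa hxa, map_smul, smul_eq_mul] at h2
    have hneg : u l < 0 := lt_of_le_of_ne (not_lt.1 hpos) hul
    nlinarith

variable [FiniteDimensional ℝ E]

/-- A polytope with a separated tiling by bodies with symmetric faces is a zonotope. -/
theorem IsSeparatedTiling.exists_eq_vadd_parallelepiped {s : Set E} (hs : s.Finite)
    (hne : s.Nonempty) {𝒯 : Set (Set E)} (h𝒯 : IsSeparatedTiling (convexHull ℝ s) 𝒯) :
    ∃ (R : Set E) (_ : Fintype R) (c : E) (a : R → E), convexHull ℝ s = c +ᵥ parallelepiped a := by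
  classical
  let D : Set E := {x | x ≠ 0 ∧ ∃ p ∈ s, ∃ q ∈ s, x = p - q}
  have hDmem : ∀ p ∈ s, ∀ q ∈ s, p ≠ q → p - q ∈ D := fun p hp q hq h =>
    ⟨sub_ne_zero.2 h, p, hp, q, hq, rfl⟩
  have hDfin : D.Finite := by
    refine ((hs.prod hs).image fun z : E × E => z.1 - z.2).subset ?_
    rintro x ⟨-, p, hp, q, hq, rfl⟩
    exact ⟨(p, q), ⟨hp, hq⟩, rfl⟩
  have hD0 : ∀ x ∈ D, x ≠ 0 := fun x hx => hx.1
  obtain ⟨R, hRD, hRcov, hRuniq⟩ := exists_direction_representatives hD0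
  have hRfin : R.Finite := hDfin.subset hRD
  let _ : Fintype R := hRfin.fintype
  have hθ : ∀ l : R, ∃ θ : StrongDual ℝ E, θ l = 1 := by
    rintro ⟨l, hl⟩
    obtain ⟨d, -, hd⟩ := exists_strongDual_ne_zero_of_notMem (p := (⊥ : Submodule ℝ E))
        (v := l) (by simpa using hD0 l (hRD hl))
    exact ⟨(d l)⁻¹ • d, by simp [hd]⟩
  choose θ hθ using hθ
  choose L hL0 hL using fun l : R => h𝒯.exists_edge_length hs hne (l := l) (θ := θ l)
    (by rw [hθ]; exact one_ne_zero)
  choose v hv using fun w : StrongDual ℝ E => maximizers_nonempty hs hne w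
  -- The vertex, in direction `w`, of the candidate zonotope with generators `L l • l`.
  let g : StrongDual ℝ E → E := fun w => ∑ l : R, (if 0 < w l then L l else 0) • (l : E)
  let A : Set (Module.Dual ℝ (StrongDual ℝ E)) :=
    (fun x : E => (ContinuousLinearMap.apply ℝ ℝ x : StrongDual ℝ E →ₗ[ℝ] ℝ)) '' D
  have hA : A.Finite := hDfin.image _
  have hAmem : ∀ x ∈ D, (ContinuousLinearMap.apply ℝ ℝ x : StrongDual ℝ E →ₗ[ℝ] ℝ) ∈ A :=
    fun x hx => ⟨x, hx, rfl⟩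
  have key : ∀ u u' : StrongDual ℝ E, (∀ a ∈ A, a u ≠ 0) → (∀ a ∈ A, a u' ≠ 0) →
      v u - g u = v u' - g u' := by
    intro u u' hu hu'
    refine eq_of_forall_adjacent_eq hA (fun u => v u - g u) ?_ hu hu'
    clear hu hu' u u'
    intro u u' w hu hu' hw hprop
    have hsign : ∀ x ∈ D, w x ≠ 0 → 0 < w x * u x ∧ 0 < w x * u' x := fun x hx h0 =>
      hw _ (hAmem x hx) h0
    have hsub : ∀ p ∈ s, ∀ q ∈ s, w (p - q) ≠ 0 →
        0 < w (p - q) * u (p - q) ∧ 0 < w (p - q) * u' (p - q) := fun p hp q hq h0 =>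
      hsign _ (hDmem p hp q hq fun h => h0 (by rw [h, sub_self, map_zero])) h0
    have hvw : ∀ x, (∀ p ∈ s, ∀ q ∈ s, w (p - q) ≠ 0 → 0 < w (p - q) * x (p - q)) →
        v x ∈ maximizers s w ∧ v x ∈ x.toExposed (w.toExposed (convexHull ℝ s)) := by
      intro x hx
      refine ⟨?_, ?_⟩
      · have := hv x
        rw [maximizers_maximizers hs hne hx] at this
        exact this.1
      · rw [← toExposed_toExposed hs hne hx]
        exact maximizers_subset_toExposed x (hv x)
    have hvu := hvw u fun p hp q hq h0 => (hsub p hp q hq h0).1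
    have hvu' := hvw u' fun p hp q hq h0 => (hsub p hp q hq h0).2
    have hterm : ∀ l : R, w l ≠ 0 →
        (if 0 < u l then L l else 0) • (l : E) = (if 0 < u' l then L l else 0) • (l : E) := by
      intro l h0
      obtain ⟨h1, h2⟩ := hsign l (hRD l.2) h0
      have h3 : 0 < u l * u' l := mul_pos_trans (by linarith) h2
      congr 2
      rcases pos_and_pos_or_neg_and_neg_of_mul_pos h3 with ⟨h4, h5⟩ | ⟨h4, h5⟩
      · simp [h4, h5]
      · simp [h4.not_gt, h5.not_gt]
    -- Either `w` lies on no wall and exposes a single vertex, or on exactly one wall, where its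
    -- face is a segment of length `L l` parallel to `l`.
    by_cases hcase : ∀ l : R, w l ≠ 0
    · have hg : g u = g u' := Finset.sum_congr rfl fun l _ => hterm l (hcase l)
      have hvv : v u = v u' := by
        by_contra hvne
        obtain ⟨l, hl, hmem⟩ := hRcov _ (hDmem _ hvu.1.1 _ hvu'.1.1 hvne)
        obtain ⟨c, hc⟩ := Submodule.mem_span_singleton.1 hmem
        have h1 : w (v u - v u') = 0 := by
          rw [map_sub, sub_eq_zero]
          exact le_antisymm (hvu'.1.2 _ hvu.1.1) (hvu.1.2 _ hvu'.1.1)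
        rw [← hc, map_smul, smul_eq_mul] at h1
        have hc0 : c = 0 := (mul_eq_zero.1 h1).resolve_right (hcase ⟨l, hl⟩)
        rw [hc0, zero_smul] at hc
        exact hvne (sub_eq_zero.1 hc.symm)
      rw [hg, hvv]
    · push Not at hcase
      obtain ⟨l, hl0⟩ := hcase
      have hpar : ∀ x ∈ D, w x = 0 → x ∈ Submodule.span ℝ {(l : E)} := by
        intro x hx h0
        obtain ⟨c, hc⟩ := hprop _ (hAmem l (hRD l.2)) _ (hAmem x hx) hl0 h0
        by_contra hnot
        obtain ⟨d, hd, hdx⟩ := exists_strongDual_ne_zero_of_notMem hnot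
        have h1 : d x = c * d l := LinearMap.congr_fun hc d
        rw [hd _ (Submodule.mem_span_singleton_self _), mul_zero] at h1
        exact hdx h1
      have hgen : ∀ p ∈ s, ∀ q ∈ s, w (p - q) = 0 → p - q ∈ Submodule.span ℝ {(l : E)} := by
        intro p hp q hq h0
        by_cases hpq : p = q
        · rw [hpq, sub_self]; exact Submodule.zero_mem _
        · exact hpar _ (hDmem p hp q hq hpq) h0
      have hvol := hL l w hl0 hgen
      have hexp : IsExposed ℝ (convexHull ℝ s) (w.toExposed (convexHull ℝ s)) :=
        ContinuousLinearMap.toExposed.isExposed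
      have hline := sub_mem_of_mem_convexHull (s := maximizers s w)
        (V := Submodule.span ℝ {(l : E)}) (fun p hp q hq => hgen p hp.1 q hq.1 (by
          rw [map_sub, sub_eq_zero]
          exact le_antisymm (hq.2 p hp.1) (hp.2 q hq.1)))
      rw [← toExposed_convexHull hs] at hline
      obtain ⟨x₀, hx₀⟩ := exists_endpoints (hexp.isCompact (hs.isCompact_convexHull (𝕜 := ℝ)))
        (hexp.convex (convex_convexHull ℝ s)) ⟨_, hvu.2.1⟩ (hθ l) hline
      rw [hvol] at hx₀
      have hrest : ∀ x : StrongDual ℝ E, g x = (if 0 < x l then L l else 0) • (l : E) +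
          ∑ l' ∈ Finset.univ.erase l, (if 0 < x l' then L l' else 0) • (l' : E) := fun x =>
        (Finset.add_sum_erase _ _ (Finset.mem_univ l)).symm
      have hsum : ∑ l' ∈ Finset.univ.erase l, (if 0 < u l' then L l' else 0) • (l' : E) =
          ∑ l' ∈ Finset.univ.erase l, (if 0 < u' l' then L l' else 0) • (l' : E) := by
        refine Finset.sum_congr rfl fun l' hl' => hterm l' fun h0 => ?_
        exact Finset.ne_of_mem_erase hl'
          (Subtype.ext (hRuniq l l.2 l' l'.2 (hpar l' (hRD l'.2) h0)))
      rw [hrest u, hrest u', hsum, hx₀ u _ (hu _ (hAmem l (hRD l.2))) hvu.2,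
        hx₀ u' _ (hu' _ (hAmem l (hRD l.2))) hvu'.2]
      abel
  have hgen : ∀ w : StrongDual ℝ E, (∀ x ∈ D, w x ≠ 0) → ∀ a ∈ A, a w ≠ 0 := by
    rintro w hw _ ⟨x, hx, rfl⟩
    exact hw x hx
  obtain ⟨c, hc⟩ : ∃ c, ∀ w : StrongDual ℝ E, (∀ x ∈ D, w x ≠ 0) → v w = c + g w := by
    -- Separation from the empty set merely supplies some generic functional.
    obtain ⟨w₀, hw₀, -⟩ := exists_generic_separation hDfin hD0 (isCompact_empty (X := E))
      convex_empty (Set.notMem_empty 0)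
    refine ⟨v w₀ - g w₀, fun w hw => ?_⟩
    rw [← key w w₀ (hgen w hw) (hgen w₀ hw₀), sub_add_cancel]
  have hvP : ∀ w, v w ∈ w.toExposed (convexHull ℝ s) := fun w =>
    maximizers_subset_toExposed w (hv w)
  have hvZ : ∀ w : StrongDual ℝ E, (∀ x ∈ D, w x ≠ 0) →
      v w ∈ w.toExposed (c +ᵥ parallelepiped fun l : R => L l • (l : E)) := by
    intro w hw
    rw [toExposed_vadd, hc w hw]
    refine ⟨g w, ⟨?_, ?_⟩, rfl⟩
    · refine (mem_parallelepiped_iff _ _).2 ⟨fun l => if 0 < w l then 1 else 0, ⟨?_, ?_⟩, ?_⟩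
      · intro l
        dsimp only
        split_ifs <;> simp
      · intro l
        dsimp only
        split_ifs <;> simp
      · refine Finset.sum_congr rfl fun l _ => ?_
        split_ifs with hpos <;> simp [hpos]
    · intro y hy
      obtain ⟨t, ⟨ht0, ht1⟩, rfl⟩ := (mem_parallelepiped_iff _ _).1 hy
      simp only [g, map_sum, map_smul, smul_eq_mul]
      refine Finset.sum_le_sum fun l _ => ?_
      have h0 : 0 ≤ t l := ht0 l
      have h1 : t l ≤ 1 := ht1 l
      have hLl := hL0 l
      split_ifs with hpos
      · have := mul_nonneg hLl hpos.le
        nlinarith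
      · have := mul_nonneg hLl (neg_nonneg.2 (not_lt.1 hpos))
        nlinarith
  refine ⟨R, inferInstance, c, fun l => L l • (l : E), ?_⟩
  -- For every generic `w` both bodies attain their maximum at the same point `v w`, whereas a point
  -- of one outside the other would be cut off by a generic functional.
  apply Set.Subset.antisymm
  · intro x hx
    by_contra hnot
    obtain ⟨w, hw, hlt⟩ := exists_generic_separation hDfin hD0
      ((isCompact_parallelepiped _).vadd c) ((convex_parallelepiped _).vadd c) hnot
    exact (hlt _ (hvZ w hw).1).not_ge ((hvP w).2 x hx)
  · intro x hx
    by_contra hnot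
    obtain ⟨w, hw, hlt⟩ := exists_generic_separation hDfin hD0
      (hs.isCompact_convexHull (𝕜 := ℝ)) (convex_convexHull ℝ s) hnot
    exact (hlt _ (hvP w).1).not_ge ((hvZ w hw).2 x hx)

end ZonotopeOfTiling

/-- A convex polytope tiled by zonotopes is a zonotope. -/
theorem IsConvexPolytope.isZonotope_of_decomposes {n : ℕ} {P : Set (EuclideanSpace ℝ (Fin n))}
    (hP : IsConvexPolytope P) (h : Decomposes P IsZonotope) : IsZonotope P := by
  obtain ⟨s, hs, hne, rfl⟩ := hP
  obtain ⟨𝒯, h𝒯, hZ⟩ := h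
  have hcomp : ∀ T ∈ 𝒯, IsCompact T := fun T hT => by
    obtain ⟨c, k, a, rfl⟩ := hZ T hT
    exact (isCompact_parallelepiped a).vadd c
  have hconv : ∀ T ∈ 𝒯, Convex ℝ T := fun T hT => by
    obtain ⟨c, k, a, rfl⟩ := hZ T hT
    exact (convex_parallelepiped a).vadd c
  have hTne : ∀ T ∈ 𝒯, T.Nonempty := fun T hT => by
    rw [← affineSpan_nonempty ℝ, h𝒯.affineSpan_eq T hT, affineSpan_nonempty]
    exact hne.convexHull
  have hsep : IsSeparatedTiling (convexHull ℝ s) 𝒯 :=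
    { finite := h𝒯.finite
      sUnion_eq := h𝒯.sUnion_eq
      isCompact := hcomp
      convex := hconv
      symmetric := fun T hT w => by
        obtain ⟨c, k, a, rfl⟩ := hZ T hT
        exact toExposed_vadd_parallelepiped_symmetric c a w
      separated := fun S hS T hT hST => by
        obtain ⟨f, c, h1, h2, y, hy, hyc⟩ := exists_proper_separation (hconv S hS) (hconv T hT)
          (hTne S hS) (hTne T hT) ((h𝒯.affineSpan_eq S hS).trans (h𝒯.affineSpan_eq T hT).symm)
          (h𝒯.disjoint_interiors S hS T hT hST)
        exact ⟨f, c, h1, h2, y, h𝒯.sUnion_eq ▸ Set.mem_sUnion_of_mem hy hS, hyc⟩ }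
  obtain ⟨R, _, c, a, h⟩ := hsep.exists_eq_vadd_parallelepiped hs hne
  rw [h]
  exact isZonotope_vadd_parallelepiped c a

theorem corollary1p7 (n : ℕ) (P : Set (EuclideanSpace ℝ (Fin n))) (hP : IsConvexPolytope P) :
    ((IsZonotope P ↔ DecomposesFaceToFace P IsZonotope) ∧
      (IsZonotope P ↔ DecomposesFaceToFace P IsParallelotope)) ∧
    ((IsZonotope P ↔ Decomposes P IsZonotope) ∧
      (IsZonotope P ↔ Decomposes P IsParallelotope)) := by
  have hback := hP.isZonotope_of_decomposes
  refine ⟨⟨⟨fun h => ?_, fun ⟨𝒯, h1, _, h3⟩ => hback ⟨𝒯, h1, h3⟩⟩,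
    ⟨fun h => h.decomposesFaceToFace,
      fun ⟨𝒯, h1, _, h3⟩ => hback ⟨𝒯, h1, fun T hT => (h3 T hT).isZonotope⟩⟩⟩,
    ⟨⟨fun h => ?_, hback⟩,
      ⟨fun h => ?_, fun ⟨𝒯, h1, h3⟩ => hback ⟨𝒯, h1, fun T hT => (h3 T hT).isZonotope⟩⟩⟩⟩ <;>
    obtain ⟨𝒯, h1, h2, h3⟩ := h.decomposesFaceToFace
  · exact ⟨𝒯, h1, h2, fun T hT => (h3 T hT).isZonotope⟩
  · exact ⟨𝒯, h1, fun T hT => (h3 T hT).isZonotope⟩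
  · exact ⟨𝒯, h1, h3⟩
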